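/- Let $p\ge 1$, $\alpha,\beta>-1$, let $\ell\ge 1$ be an integer and $\varpi=(\omega_0,\dots,\omega_{\ell-1})\in\mathbb{R}^{\ell}$. Put $d\mu(x)=(1-x)^{\alpha}(1+x)^{\beta}\,dx$ on $[-1,1]$ and $$\|f\|=\Big(\sum_{k=0}^{\ell-1}|f^{(k)}(\omega_k)|^p+\int_{-1}^{1}|f^{(\ell)}(x)|^p\,d\mu(x)\Big)^{1/p}.$$ This is a seminorm on the linear space of all functions $f:\mathbb{R}\to\mathbb{R}$ such that (1) $f$ has a derivative of order $k$ at $\omega_k$ for $k=1,\dots,\ell-1$; (2) $f$ is $\ell-1$ times differentiable on $(-1,1)$ and $f^{(\ell-1)}$ is absolutely continuous on every compact subset of $(-1,1)$; (3) $f^{(\ell)}\in L^p(\mu)$. Let $\mathbf{U}$ be the normed space of the equivalence classes of such functions under $f\sim g\iff\|f-g\|=0$, and let $\mathbf{W}$ be the completion of the space $\mathbb{P}$ of real polynomials under $\|\cdot\|$. **Theorem.** $\mathbf{U}$ is complete if and only if one of the following holds: - $\ell=1$; - $\ell\ge2$, $p>1$ and, for every $m=1,\dots,\ell-1$: $\omega_{\ell-m}\ne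 1$ if $\alpha\ge mp-1$, and $\omega_{\ell-m}\neq-1$ if $\beta\ge mp-1$; - $\ell\ge2$, $p=1$ and, for every $m=1,\dots,\ell-1$: $\omega_{\ell-m}\ne 1$ if $\alpha> m-1$, and $\omega_{\ell-m}\neq-1$ if $\beta> m-1$. Moreover, if $\mathbf{U}$ is complete then $\mathbf{U}=\mathbf{W}$, that is, there is a linear isometric bijection of $\mathbf{U}$ onto $\mathbf{W}$ that carries the class of each polynomial to its image in the completion. -/

import Mathlib

open MeasureTheory Set Filter Topology

noncomputable section

namespace JacobiSobolev

/-- `HasDerivOfOrder f k x`: the function `f : ℝ → ℝ` has a derivative of order `k` at `x`,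
i.e. it has one of order `k - 1` at all points near `x` and `f^(k-1)` is differentiable at `x`
(no condition for `k = 0`).  Its value is then `iteratedDeriv k f x`. -/
def HasDerivOfOrder (f : ℝ → ℝ) : ℕ → ℝ → Prop
  | 0, _ => True
  | k + 1, x => (∀ᶠ y in 𝓝 x, HasDerivOfOrder f k y) ∧ DifferentiableAt ℝ (iteratedDeriv k f) x

/-- The Jacobi measure `(1 - x)^α (1 + x)^β dx` on `[-1, 1]`. -/
def jacobiMeasure (α β : ℝ) : Measure ℝ :=
  (volume.restrict (Icc (-1) 1)).withDensity
    (fun x => ENNReal.ofReal ((1 - x) ^ α * (1 + x) ^ β))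

/-- The functions with finite discrete-continuous Jacobi–Sobolev seminorm.  Every compact subset
of `(-1, 1)` lies in a compact interval `[a, b] ⊆ (-1, 1)`, so absolute continuity on compact
subsets is absolute continuity on those intervals. -/
structure IsSobolev (p α β : ℝ) {ℓ : ℕ} (ω : Fin ℓ → ℝ) (f : ℝ → ℝ) : Prop where
  deriv_at : ∀ k : Fin ℓ, HasDerivOfOrder f k (ω k)
  deriv_on : ∀ x ∈ Ioo (-1 : ℝ) 1, HasDerivOfOrder f (ℓ - 1) x
  absCont : ∀ a b : ℝ, -1 < a → a ≤ b → b < 1 →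
    AbsolutelyContinuousOnInterval (iteratedDeriv (ℓ - 1) f) a b
  memLp : MemLp (iteratedDeriv ℓ f) (ENNReal.ofReal p) (jacobiMeasure α β)

/-- The Jacobi–Sobolev seminorm
`(∑_{k<ℓ} |f^(k)(ω_k)|^p + ∫_{-1}^{1} |f^(ℓ)|^p dμ)^(1/p)`. -/
def sobolevNorm (p α β : ℝ) {ℓ : ℕ} (ω : Fin ℓ → ℝ) (f : ℝ → ℝ) : ℝ :=
  (∑ k : Fin ℓ, |iteratedDeriv k f (ω k)| ^ p
    + ∫ x, |iteratedDeriv ℓ f x| ^ p ∂(jacobiMeasure α β)) ^ (1 / p)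

/-! ### Linearity of the derivatives -/

theorem HasDerivOfOrder.comb {f g : ℝ → ℝ} (a b : ℝ) : ∀ {k : ℕ} {x : ℝ},
    HasDerivOfOrder f k x → HasDerivOfOrder g k x →
    HasDerivOfOrder (a • f + b • g) k x ∧
      iteratedDeriv k (a • f + b • g) x = a * iteratedDeriv k f x + b * iteratedDeriv k g x := by
  intro k
  induction k with
  | zero => intro x _ _; exact ⟨trivial, by simp⟩
  | succ k ih =>
    intro x hf hg
    have hev : iteratedDeriv k (a • f + b • g) =ᶠ[𝓝 x]
        fun y => a * iteratedDeriv k f y + b * iteratedDeriv k g y := by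
      filter_upwards [hf.1, hg.1] with y h1 h2 using (ih h1 h2).2
    have hd : HasDerivAt (fun y => a * iteratedDeriv k f y + b * iteratedDeriv k g y)
        (a * deriv (iteratedDeriv k f) x + b * deriv (iteratedDeriv k g) x) x :=
      (hf.2.hasDerivAt.const_mul a).add (hg.2.hasDerivAt.const_mul b)
    refine ⟨⟨?_, ?_⟩, ?_⟩
    · filter_upwards [hf.1, hg.1] with y h1 h2 using (ih h1 h2).1
    · exact hev.differentiableAt_iff.2 hd.differentiableAt
    · rw [iteratedDeriv_succ, iteratedDeriv_succ, iteratedDeriv_succ, hev.deriv_eq, hd.deriv]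

theorem ae_jacobi_of_ae {α β : ℝ} {q : ℝ → Prop}
    (h : ∀ᵐ x ∂volume, x ∈ Ioo (-1 : ℝ) 1 → q x) : ∀ᵐ x ∂(jacobiMeasure α β), q x := by
  have hac : jacobiMeasure α β ≪ volume.restrict (Icc (-1) 1) :=
    withDensity_absolutelyContinuous _ _
  refine hac.ae_le ?_
  rw [Measure.restrict_congr_set (Ioo_ae_eq_Icc (μ := volume) (a := (-1 : ℝ)) (b := 1)).symm]
  exact (ae_restrict_iff' measurableSet_Ioo).2 h

variable {p α β : ℝ} {ℓ : ℕ} {ω : Fin ℓ → ℝ}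

theorem IsSobolev.ae_differentiableAt {f : ℝ → ℝ} (hf : IsSobolev p α β ω f) :
    ∀ᵐ x ∂volume, x ∈ Ioo (-1 : ℝ) 1 → DifferentiableAt ℝ (iteratedDeriv (ℓ - 1) f) x := by
  obtain ⟨u, _, hu1, hu⟩ := exists_seq_strictMono_tendsto' (show (0 : ℝ) < 1 by norm_num)
  have key : ∀ n, ∀ᵐ x ∂volume, x ∈ uIcc (-(u n)) (u n) →
      DifferentiableAt ℝ (iteratedDeriv (ℓ - 1) f) x := fun n =>
    (hf.absCont (-(u n)) (u n) (by linarith [(hu1 n).2]) (by linarith [(hu1 n).1])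
      (hu1 n).2).ae_differentiableAt
  filter_upwards [ae_all_iff.2 key] with x hx hx1
  obtain ⟨n, hn⟩ := (hu.eventually (lt_mem_nhds (abs_lt.2 hx1))).exists
  apply hx n
  rw [uIcc_of_le (by linarith [(hu1 n).1])]
  exact ⟨(abs_lt.1 hn).1.le, (abs_lt.1 hn).2.le⟩

theorem IsSobolev.ae_comb {f g : ℝ → ℝ} (hf : IsSobolev p α β ω f) (hg : IsSobolev p α β ω g)
    (a b : ℝ) : iteratedDeriv ℓ (a • f + b • g) =ᵐ[jacobiMeasure α β]
      a • iteratedDeriv ℓ f + b • iteratedDeriv ℓ g := by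
  apply ae_jacobi_of_ae
  filter_upwards [hf.ae_differentiableAt, hg.ae_differentiableAt] with x h1 h2 hx
  rcases Nat.eq_zero_or_pos ℓ with h0 | h0
  · subst h0; simp
  · obtain ⟨n, rfl⟩ : ∃ n, ℓ = n + 1 := ⟨ℓ - 1, by omega⟩
    have hn : ∀ᶠ y in 𝓝 x, y ∈ Ioo (-1 : ℝ) 1 := Ioo_mem_nhds hx.1 hx.2
    have hF : HasDerivOfOrder f (n + 1) x :=
      ⟨by filter_upwards [hn] with y hy using hf.deriv_on y hy, h1 hx⟩
    have hG : HasDerivOfOrder g (n + 1) x :=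
      ⟨by filter_upwards [hn] with y hy using hg.deriv_on y hy, h2 hx⟩
    simpa using (hF.comb a b hG).2

theorem IsSobolev.comb {f g : ℝ → ℝ} (hf : IsSobolev p α β ω f) (hg : IsSobolev p α β ω g)
    (a b : ℝ) : IsSobolev p α β ω (a • f + b • g) where
  deriv_at k := ((hf.deriv_at k).comb a b (hg.deriv_at k)).1
  deriv_on x hx := ((hf.deriv_on x hx).comb a b (hg.deriv_on x hx)).1
  absCont s t hs hst ht := by
    have h := ((hf.absCont s t hs hst ht).const_mul a).add ((hg.absCont s t hs hst ht).const_mul b)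
    have heq : ∀ x ∈ uIcc s t, iteratedDeriv (ℓ - 1) (a • f + b • g) x =
        a * iteratedDeriv (ℓ - 1) f x + b * iteratedDeriv (ℓ - 1) g x := by
      intro x hx
      rw [uIcc_of_le hst] at hx
      have hx' : x ∈ Ioo (-1 : ℝ) 1 := ⟨hs.trans_le hx.1, hx.2.trans_lt ht⟩
      exact ((hf.deriv_on x hx').comb a b (hg.deriv_on x hx')).2
    rw [absolutelyContinuousOnInterval_iff] at h ⊢
    intro ε hε
    obtain ⟨δ, hδ, h⟩ := h ε hε
    refine ⟨δ, hδ, fun E hE hl => ?_⟩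
    refine lt_of_le_of_lt (le_of_eq ?_) (h E hE hl)
    refine Finset.sum_congr rfl fun i hi => ?_
    rw [heq _ (hE.1 i hi).1, heq _ (hE.1 i hi).2]
    rfl
  memLp := (memLp_congr_ae (hf.ae_comb hg a b)).2
    ((hf.memLp.const_smul a).add (hg.memLp.const_smul b))

theorem _root_.ContDiff.hasDerivOfOrder {f : ℝ → ℝ} (hf : ContDiff ℝ (⊤ : ℕ∞) f) :
    ∀ (k : ℕ) (x : ℝ), HasDerivOfOrder f k x
  | 0, _ => trivial
  | k + 1, x => ⟨Eventually.of_forall fun y => hf.hasDerivOfOrder k y,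
      (hf.differentiable_iteratedDeriv k (by exact_mod_cast WithTop.coe_lt_top k)) x⟩

instance isFiniteMeasure_jacobi (α β : ℝ) [hα : Fact (-1 < α)] [hβ : Fact (-1 < β)] :
    IsFiniteMeasure (jacobiMeasure α β) := by
  have h1 : IntervalIntegrable (fun x : ℝ => (1 - x) ^ α * (1 + x) ^ β) volume (-1) 0 := by
    have h : IntervalIntegrable (fun x : ℝ => (1 + x) ^ β) volume (-1) 0 := by
      have := (intervalIntegral.intervalIntegrable_rpow' (a := 0) (b := 1) hβ.out).comp_add_left 1
      simpa using this
    apply h.continuousOn_mul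
    intro x hx
    rw [uIcc_of_le (by norm_num)] at hx
    exact (ContinuousAt.rpow_const (by fun_prop) (Or.inl (by linarith [hx.2]))).continuousWithinAt
  have h2 : IntervalIntegrable (fun x : ℝ => (1 - x) ^ α * (1 + x) ^ β) volume 0 1 := by
    have h : IntervalIntegrable (fun x : ℝ => (1 - x) ^ α) volume 0 1 := by
      have := (intervalIntegral.intervalIntegrable_rpow' (a := 0) (b := 1) hα.out).comp_sub_left 1
      simpa using this.symm
    apply h.mul_continuousOn
    intro x hx
    rw [uIcc_of_le (by norm_num)] at hx
    exact (ContinuousAt.rpow_const (by fun_prop) (Or.inl (by linarith [hx.1]))).continuousWithinAt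
  have h3 := (intervalIntegrable_iff_integrableOn_Icc_of_le (by norm_num)).1 (h1.trans h2)
  exact isFiniteMeasure_withDensity_ofReal h3.2

theorem contDiff_polynomial (P : Polynomial ℝ) :
    ContDiff ℝ (⊤ : ℕ∞) (fun x => P.eval x) := by
  simpa using P.contDiff_aeval (𝕜 := ℝ) (⊤ : ℕ∞)

theorem isSobolev_polynomial [Fact (-1 < α)] [Fact (-1 < β)] (P : Polynomial ℝ) :
    IsSobolev p α β ω (fun x => P.eval x) where
  deriv_at k := (contDiff_polynomial P).hasDerivOfOrder k _
  deriv_on x _ := (contDiff_polynomial P).hasDerivOfOrder _ x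
  absCont a b _ _ _ := by
    refine ContDiffOn.absolutelyContinuousOnInterval (ContDiff.contDiffOn ?_)
    rw [iteratedDeriv_eq_iterate]
    exact ContDiff.iterate_deriv' 1 (ℓ - 1) (contDiff_infty.1 (contDiff_polynomial P) _)
  memLp := by
    have hc : Continuous (iteratedDeriv ℓ (fun x => P.eval x)) :=
      (contDiff_polynomial P).continuous_iteratedDeriv ℓ
        (by exact_mod_cast le_top)
    obtain ⟨C, hC⟩ := (isCompact_Icc (a := (-1 : ℝ)) (b := 1)).exists_bound_of_continuousOn
      hc.continuousOn
    refine MemLp.of_bound hc.aestronglyMeasurable C (ae_jacobi_of_ae ?_)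
    exact Eventually.of_forall fun x hx => hC x (Ioo_subset_Icc_self hx)

/-! ### Minkowski's inequality and homogeneity -/

theorem integral_nonneg_jacobi (f : ℝ → ℝ) :
    0 ≤ ∫ x, |iteratedDeriv ℓ f x| ^ p ∂(jacobiMeasure α β) :=
  integral_nonneg fun _ => by positivity

theorem integral_eq_eLpNorm (hp : 1 ≤ p) {g : ℝ → ℝ}
    (hg : MemLp g (ENNReal.ofReal p) (jacobiMeasure α β)) :
    ∫ x, |g x| ^ p ∂(jacobiMeasure α β)
      = |(eLpNorm g (ENNReal.ofReal p) (jacobiMeasure α β)).toReal| ^ p := by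
  have hp0 : 0 < p := by linarith
  have h0 : 0 ≤ ∫ x, |g x| ^ p ∂(jacobiMeasure α β) := integral_nonneg fun _ => by positivity
  rw [abs_of_nonneg ENNReal.toReal_nonneg,
    hg.eLpNorm_eq_integral_rpow_norm (by simpa using hp0) ENNReal.ofReal_ne_top,
    ENNReal.toReal_ofReal hp0.le, ENNReal.toReal_ofReal (by positivity)]
  simp only [Real.norm_eq_abs]
  rw [Real.rpow_inv_rpow h0 hp0.ne']

theorem sobolevNorm_add_le (hp : 1 ≤ p) {f g : ℝ → ℝ} (hf : IsSobolev p α β ω f)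
    (hg : IsSobolev p α β ω g) :
    sobolevNorm p α β ω (f + g) ≤ sobolevNorm p α β ω f + sobolevNorm p α β ω g := by
  have hp0 : 0 < p := by linarith
  have hfg : IsSobolev p α β ω (f + g) := by simpa using hf.comb hg 1 1
  have hae : iteratedDeriv ℓ (f + g) =ᵐ[jacobiMeasure α β]
      iteratedDeriv ℓ f + iteratedDeriv ℓ g := by simpa using hf.ae_comb hg 1 1
  have hpt : ∀ k : Fin ℓ, iteratedDeriv k (f + g) (ω k)
      = iteratedDeriv k f (ω k) + iteratedDeriv k g (ω k) := fun k => by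
    simpa using ((hf.deriv_at k).comb 1 1 (hg.deriv_at k)).2
  set N : (ℝ → ℝ) → ℝ := fun h =>
    (eLpNorm (iteratedDeriv ℓ h) (ENNReal.ofReal p) (jacobiMeasure α β)).toReal with hN
  let v : (ℝ → ℝ) → Option (Fin ℓ) → ℝ := fun h o => o.elim (N h) fun k => iteratedDeriv k h (ω k)
  have hv : ∀ h, IsSobolev p α β ω h →
      sobolevNorm p α β ω h = (∑ o, |v h o| ^ p) ^ (1 / p) := by
    intro h hh
    rw [sobolevNorm, integral_eq_eLpNorm hp hh.memLp, Fintype.sum_option, add_comm]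
    rfl
  rw [hv _ hfg, hv _ hf, hv _ hg]
  refine le_trans ?_ (Real.Lp_add_le Finset.univ (v f) (v g) hp)
  refine Real.rpow_le_rpow (by positivity) (Finset.sum_le_sum fun o _ => ?_) (by positivity)
  refine Real.rpow_le_rpow (abs_nonneg _) ?_ hp0.le
  rcases o with _ | k
  · have h1 : N (f + g) ≤ N f + N g := by
      simp only [hN]
      rw [eLpNorm_congr_ae hae, ← ENNReal.toReal_add hf.memLp.2.ne hg.memLp.2.ne]
      refine ENNReal.toReal_mono (ENNReal.add_ne_top.2 ⟨hf.memLp.2.ne, hg.memLp.2.ne⟩) ?_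
      exact eLpNorm_add_le hf.memLp.1 hg.memLp.1 (by simpa using hp)
    change |N (f + g)| ≤ |N f + N g|
    have h0 : ∀ h, 0 ≤ N h := fun h => ENNReal.toReal_nonneg
    rw [abs_of_nonneg (h0 _), abs_of_nonneg (add_nonneg (h0 _) (h0 _))]
    exact h1
  · exact le_of_eq (congrArg _ (hpt k))

theorem sobolevNorm_smul (hp : 1 ≤ p) (a : ℝ) {f : ℝ → ℝ} (hf : IsSobolev p α β ω f) :
    sobolevNorm p α β ω (a • f) = |a| * sobolevNorm p α β ω f := by
  have hp0 : 0 < p := by linarith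
  have hae : iteratedDeriv ℓ (a • f) =ᵐ[jacobiMeasure α β] a • iteratedDeriv ℓ f := by
    simpa using hf.ae_comb hf a 0
  have hpt : ∀ k : Fin ℓ, iteratedDeriv k (a • f) (ω k) = a * iteratedDeriv k f (ω k) := fun k => by
    simpa using ((hf.deriv_at k).comb a 0 (hf.deriv_at k)).2
  have hint : ∫ x, |iteratedDeriv ℓ (a • f) x| ^ p ∂(jacobiMeasure α β)
      = |a| ^ p * ∫ x, |iteratedDeriv ℓ f x| ^ p ∂(jacobiMeasure α β) := by
    rw [← integral_const_mul]
    refine integral_congr_ae ?_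
    filter_upwards [hae] with x hx
    rw [hx, Pi.smul_apply, smul_eq_mul, abs_mul, Real.mul_rpow (abs_nonneg _) (abs_nonneg _)]
  have h0 := integral_nonneg_jacobi (p := p) (α := α) (β := β) (ℓ := ℓ) f
  rw [sobolevNorm, sobolevNorm, hint]
  simp only [hpt, abs_mul, Real.mul_rpow (abs_nonneg _) (abs_nonneg _)]
  rw [← Finset.mul_sum, ← mul_add, Real.mul_rpow (by positivity) (by positivity), one_div,
    Real.rpow_rpow_inv (abs_nonneg a) hp0.ne']

/-! ### The seminormed space of functions and its quotient `U` -/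

/-- The linear space of functions with finite Jacobi–Sobolev seminorm, as a subspace of `ℝ → ℝ`. -/
def preU (p α β : ℝ) {ℓ : ℕ} (ω : Fin ℓ → ℝ) [Fact (-1 < α)] [Fact (-1 < β)] :
    Submodule ℝ (ℝ → ℝ) where
  carrier := {f | IsSobolev p α β ω f}
  zero_mem' := by
    have h := isSobolev_polynomial (p := p) (α := α) (β := β) (ω := ω) 0
    have h0 : (fun x : ℝ => (0 : Polynomial ℝ).eval x) = 0 := by ext x; simp
    rwa [h0] at h
  add_mem' {f g} hf hg := by simpa using IsSobolev.comb hf hg 1 1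
  smul_mem' a f hf := by simpa using IsSobolev.comb hf hf a 0

/-- The same space as a type of its own, which carries the Jacobi–Sobolev seminorm (and not the
topology of pointwise convergence). -/
def SobolevFun (p α β : ℝ) {ℓ : ℕ} (ω : Fin ℓ → ℝ) [Fact (-1 < α)] [Fact (-1 < β)] : Type :=
  preU p α β ω

section

variable [Fact (-1 < α)] [Fact (-1 < β)]

instance : AddCommGroup (SobolevFun p α β ω) := inferInstanceAs (AddCommGroup (preU p α β ω))

instance : Module ℝ (SobolevFun p α β ω) := inferInstanceAs (Module ℝ (preU p α β ω))

/-- The function underlying an element of `SobolevFun`. -/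
def SobolevFun.toFun (f : SobolevFun p α β ω) : ℝ → ℝ := f.1

theorem SobolevFun.isSobolev (f : SobolevFun p α β ω) : IsSobolev p α β ω f.toFun := f.2

variable [hp : Fact (1 ≤ p)]

/-- The Jacobi–Sobolev seminorm on the linear space of functions. -/
instance : SeminormedAddCommGroup (SobolevFun p α β ω) :=
  AddGroupSeminorm.toSeminormedAddCommGroup
    { toFun := fun f => sobolevNorm p α β ω f.toFun
      map_zero' := by
        have h := sobolevNorm_smul hp.out 0 (0 : SobolevFun p α β ω).isSobolev
        rw [zero_smul, abs_zero, zero_mul] at h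
        exact h
      add_le' := fun f g => sobolevNorm_add_le hp.out f.isSobolev g.isSobolev
      neg' := fun f => by
        have h := sobolevNorm_smul hp.out (-1) f.isSobolev
        rw [abs_neg, abs_one, one_mul, neg_one_smul] at h
        exact h }

theorem norm_def (f : SobolevFun p α β ω) : ‖f‖ = sobolevNorm p α β ω f.toFun := rfl

instance : NormedSpace ℝ (SobolevFun p α β ω) where
  norm_smul_le a f := (sobolevNorm_smul hp.out a f.isSobolev).le

end

/-- The normed space `U`: functions with finite Jacobi–Sobolev seminorm, where `f ~ g` if and only
if the seminorm of `f - g` is `0`. -/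
abbrev U (p α β : ℝ) {ℓ : ℕ} (ω : Fin ℓ → ℝ) [Fact (1 ≤ p)] [Fact (-1 < α)] [Fact (-1 < β)] :
    Type :=
  SeparationQuotient (SobolevFun p α β ω)

/-! ### The polynomials and their completion `W` -/

/-- The linear space of real polynomials, as a type that carries the Jacobi–Sobolev norm. -/
def SobolevPoly (p α β : ℝ) {ℓ : ℕ} (_ω : Fin ℓ → ℝ) [Fact (1 ≤ p)] [Fact (-1 < α)]
    [Fact (-1 < β)] : Type :=
  Polynomial ℝ

section

variable [Fact (1 ≤ p)] [Fact (-1 < α)] [Fact (-1 < β)]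

instance : AddCommGroup (SobolevPoly p α β ω) := inferInstanceAs (AddCommGroup (Polynomial ℝ))

instance : Module ℝ (SobolevPoly p α β ω) := inferInstanceAs (Module ℝ (Polynomial ℝ))

/-- The underlying polynomial. -/
def SobolevPoly.poly (P : SobolevPoly p α β ω) : Polynomial ℝ := P

/-- A polynomial as a function with finite Jacobi–Sobolev seminorm. -/
def SobolevPoly.toFun : SobolevPoly p α β ω →ₗ[ℝ] SobolevFun p α β ω where
  toFun P := ⟨fun x => P.poly.eval x, isSobolev_polynomial P.poly⟩
  map_add' P Q := Subtype.ext (funext fun _ => Polynomial.eval_add (p := P.poly) (q := Q.poly))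
  map_smul' a P := Subtype.ext (funext fun x => Polynomial.eval_smul (S := ℝ) a P.poly x)

instance : SeminormedAddCommGroup (SobolevPoly p α β ω) :=
  SeminormedAddCommGroup.induced _ _ (SobolevPoly.toFun (p := p) (α := α) (β := β) (ω := ω))

instance : NormedSpace ℝ (SobolevPoly p α β ω) :=
  NormedSpace.induced ℝ _ _ (SobolevPoly.toFun (p := p) (α := α) (β := β) (ω := ω))

theorem SobolevPoly.norm_def (P : SobolevPoly p α β ω) :
    ‖P‖ = sobolevNorm p α β ω (fun x => P.poly.eval x) := rfl

end

/-- The discrete-continuous Jacobi–Sobolev space `W`: the abstract completion (Cauchy sequences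
modulo null sequences) of the polynomials under the Jacobi–Sobolev norm. -/
abbrev W (p α β : ℝ) {ℓ : ℕ} (ω : Fin ℓ → ℝ) [Fact (1 ≤ p)] [Fact (-1 < α)] [Fact (-1 < β)] :
    Type :=
  UniformSpace.Completion (SobolevPoly p α β ω)

/-- The class in `U` of a polynomial. -/
def polyU [Fact (1 ≤ p)] [Fact (-1 < α)] [Fact (-1 < β)] (P : SobolevPoly p α β ω) :
    U p α β ω :=
  SeparationQuotient.mk (SobolevPoly.toFun P)

/-- The image in `W` of a polynomial. -/
def polyW [Fact (1 ≤ p)] [Fact (-1 < α)] [Fact (-1 < β)] (P : SobolevPoly p α β ω) :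
    W p α β ω :=
  (P : UniformSpace.Completion (SobolevPoly p α β ω))

end JacobiSobolev

end

noncomputable section

namespace JacobiSobolev

/-! ### Polynomials -/

/-! The map `f ↦ ((f^(k)(ω_k))_k, f^(ℓ))` is an isometry into the complete space `ℝ^ℓ × L^p(μ)`. The
polynomials already have dense image: they are dense in `L^p(μ)`, and Abel–Gončarov interpolation
matches the point values exactly (`denseRange_dataMap_polynomial`). Hence `U` is complete iff the
map is onto, that is, iff every `g ∈ L^p(μ)` is `f^(ℓ)` for some admissible `f`
(`completeSpace_U_iff`). By the same density, a complete `U` is a completion of the polynomials,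
hence `W`.

The equation `f^(ℓ) = g` can always be solved inside `(-1, 1)`, and outside this interval `f` is
free. The only obstruction is a node `ω_k = ±1` with `k ≥ 1`, where `f^(k-1)` must be
differentiable. At `1`, put `m = ℓ - k - 1`: `f^(k)` is a primitive of `g` of order `m + 1`.

Sufficiency: this primitive has a limit at `1` if `(1 - t)^m g` is integrable there, which Young's
inequality (or a pointwise bound if `p = 1`) derives from the inequality on `α`. Extending `f^(k)`
by its limit and integrating `k` times gives `f` (`exists_iterated_primitive`).

Necessity: if the inequality fails, there is a `φ` that tends to infinity at `1` with `φ^(m+1)` in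
the weighted `L^p`: `log (1 - log (1 - t))` for `p > 1` and `-log (1 - t)` for `p = 1`. A solution
for `g = φ^(m+1)` on `(0, 1)` has `f^(k) - φ` bounded there, so `f^(k)` tends to infinity and
`f^(k-1)` is not differentiable at `1` (`IsSolvable.not_tendsto_atTop`). Reflection handles `-1`. -/

theorem iteratedDeriv_polynomial (P : Polynomial ℝ) (k : ℕ) :
    iteratedDeriv k (fun x => P.eval x) = fun x => (Polynomial.derivative^[k] P).eval x := by
  induction k with
  | zero => simp
  | succ k ih =>
    ext x
    rw [iteratedDeriv_succ, ih, Polynomial.deriv, Function.iterate_succ_apply']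

theorem exists_polynomial_iterate_derivative_eq (R : Polynomial ℝ) (n : ℕ) :
    ∃ P : Polynomial ℝ, Polynomial.derivative^[n] P = R := by
  have h1 : Function.Surjective (Polynomial.derivative : Polynomial ℝ →ₗ[ℝ] Polynomial ℝ) := by
    intro R
    induction R using Polynomial.induction_on' with
    | add P Q hP hQ =>
      obtain ⟨P, rfl⟩ := hP
      obtain ⟨Q, rfl⟩ := hQ
      exact ⟨P + Q, map_add _ _ _⟩
    | monomial n a =>
      refine ⟨Polynomial.monomial (n + 1) (a / (n + 1)), ?_⟩
      rw [Polynomial.derivative_monomial]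
      have : (n : ℝ) + 1 ≠ 0 := by positivity
      simp [this]
  exact h1.iterate n R

/-- Abel–Gončarov interpolation: one prescribes one derivative of each order below `n`. -/
theorem exists_polynomial_interpolation (n : ℕ) (ω v : ℕ → ℝ) :
    ∃ Q : Polynomial ℝ, Polynomial.derivative^[n] Q = 0 ∧
      ∀ k < n, (Polynomial.derivative^[k] Q).eval (ω k) = v k := by
  induction n generalizing v with
  | zero => exact ⟨0, by simp, by simp⟩
  | succ n ih =>
    -- The system is triangular: `R` settles order `n`, where `Q` contributes nothing, and `Q`
    -- corrects the values of `R` at the lower orders.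
    obtain ⟨R, hR⟩ := exists_polynomial_iterate_derivative_eq (Polynomial.C (v n)) n
    obtain ⟨Q, hQ, hQv⟩ := ih (fun k => v k - (Polynomial.derivative^[k] R).eval (ω k))
    refine ⟨Q + R, ?_, fun k hk => ?_⟩
    · rw [iterate_map_add, Function.iterate_succ_apply',
        Function.iterate_succ_apply', hQ, hR]
      simp
    · rw [iterate_map_add, Polynomial.eval_add]
      rcases Nat.lt_succ_iff_lt_or_eq.1 hk with h | rfl
      · rw [hQv k h]; ring
      · rw [hQ, hR]; simp

theorem exists_polynomial_data {ℓ : ℕ} (ω v : Fin ℓ → ℝ) (R : Polynomial ℝ) :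
    ∃ P : Polynomial ℝ, iteratedDeriv ℓ (fun x => P.eval x) = (fun x => R.eval x) ∧
      ∀ k : Fin ℓ, iteratedDeriv k (fun x => P.eval x) (ω k) = v k := by
  obtain ⟨S, hS⟩ := exists_polynomial_iterate_derivative_eq R ℓ
  obtain ⟨Q, hQ, hQv⟩ := exists_polynomial_interpolation ℓ
    (fun k => if h : k < ℓ then ω ⟨k, h⟩ else 0)
    (fun k => if h : k < ℓ then v ⟨k, h⟩ - (Polynomial.derivative^[k] S).eval (ω ⟨k, h⟩) else 0)
  refine ⟨Q + S, ?_, fun k => ?_⟩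
  · rw [iteratedDeriv_polynomial, iterate_map_add, hQ, hS, zero_add]
  · have := hQv k k.2
    simp only [k.2, dif_pos, Fin.eta] at this
    rw [iteratedDeriv_polynomial, iterate_map_add]
    simp only [Polynomial.eval_add, this]
    ring

/-- The measure is finite, so bounded continuous functions are dense in `L^p`, and Weierstrass
approximation on `[-1, 1]` replaces them by polynomials. -/
theorem exists_polynomial_eLpNorm_sub_le {α β p : ℝ} [Fact (-1 < α)] [Fact (-1 < β)]
    {g : ℝ → ℝ} (hp : 1 ≤ p)
    (hg : MemLp g (ENNReal.ofReal p) (jacobiMeasure α β)) {ε : ENNReal} (hε : ε ≠ 0) :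
    ∃ R : Polynomial ℝ,
      eLpNorm (g - fun x => R.eval x) (ENNReal.ofReal p) (jacobiMeasure α β) ≤ ε := by
  have hp1 : 1 ≤ ENNReal.ofReal p := by simpa using hp
  set μ := jacobiMeasure α β
  obtain ⟨φ, hφ, hφm⟩ := hg.exists_boundedContinuous_eLpNorm_sub_le ENNReal.ofReal_ne_top
    (ENNReal.half_pos hε).ne'
  -- The factor by which a uniform bound turns into an `L^p` bound.
  set c : ENNReal := μ univ ^ (ENNReal.ofReal p).toReal⁻¹
  have hc : c ≠ ⊤ := ENNReal.rpow_ne_top_of_nonneg (by positivity) (measure_ne_top _ _)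
  obtain ⟨δ, hδ, hδε⟩ : ∃ δ : ℝ, 0 < δ ∧ c * ENNReal.ofReal δ ≤ ε / 2 := by
    by_cases he : ε = ⊤
    · exact ⟨1, one_pos, by simp [he, ENNReal.top_div]⟩
    obtain ⟨δ, hδ, h⟩ := ENNReal.exists_nnreal_pos_mul_lt hc (ENNReal.half_pos hε).ne'
    refine ⟨δ, hδ, ?_⟩
    rw [mul_comm, ENNReal.ofReal_coe_nnreal]
    exact h.le
  obtain ⟨R, hR⟩ := exists_polynomial_near_of_continuousOn (-1) 1 φ φ.continuous.continuousOn δ hδ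
  refine ⟨R, ?_⟩
  have h2 : eLpNorm ((φ : ℝ → ℝ) - fun x => R.eval x) (ENNReal.ofReal p) μ ≤ ε / 2 := by
    refine le_trans (eLpNorm_le_of_ae_bound (C := δ) (ae_jacobi_of_ae ?_)) hδε
    refine Eventually.of_forall fun x hx => ?_
    rw [Real.norm_eq_abs, Pi.sub_apply, abs_sub_comm]
    exact (hR x (Ioo_subset_Icc_self hx)).le
  have h3 : g - (fun x => R.eval x) = (g - φ) + ((φ : ℝ → ℝ) - fun x => R.eval x) := by
    ext x; simp
  rw [h3]
  refine (eLpNorm_add_le (hg.sub hφm).1 (hφm.1.sub R.continuous.aestronglyMeasurable) hp1).trans ?_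
  exact (add_le_add hφ h2).trans (ENNReal.add_halves ε).le

/-! ### The isometry into `ℝ^ℓ × L^p(μ)` -/

section

variable {p α β : ℝ} {ℓ : ℕ} {ω : Fin ℓ → ℝ}
variable [hp : Fact (1 ≤ p)] [Fact (-1 < α)] [Fact (-1 < β)]

instance fact_one_le_ofReal : Fact (1 ≤ ENNReal.ofReal p) :=
  ⟨by simpa using hp.out⟩

/-- The product of `ℝ^ℓ` and `L^p(μ)`, with the `p`-norm of the two norms. -/
abbrev DataSpace (p α β : ℝ) (ℓ : ℕ) [Fact (1 ≤ p)] : Type :=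
  WithLp (ENNReal.ofReal p)
    (PiLp (ENNReal.ofReal p) (fun _ : Fin ℓ => ℝ) × Lp ℝ (ENNReal.ofReal p) (jacobiMeasure α β))

/-- The map `f ↦ ((f^(k)(ω_k))_k, f^(ℓ))`. -/
def dataMap : SobolevFun p α β ω →ₗ[ℝ] DataSpace p α β ℓ where
  toFun f := WithLp.toLp _ (WithLp.toLp _ fun k => iteratedDeriv k f.toFun (ω k),
    f.isSobolev.memLp.toLp _)
  map_add' f g := by
    have h1 : ∀ k : Fin ℓ, iteratedDeriv k (f + g).toFun (ω k) =
        iteratedDeriv k f.toFun (ω k) + iteratedDeriv k g.toFun (ω k) := fun k => by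
      have := ((f.isSobolev.deriv_at k).comb 1 1 (g.isSobolev.deriv_at k)).2
      simp only [one_smul, one_mul] at this
      exact this
    have h2 : (f + g).isSobolev.memLp.toLp _ =
        f.isSobolev.memLp.toLp _ + g.isSobolev.memLp.toLp _ := by
      rw [← MemLp.toLp_add]
      refine MemLp.toLp_congr _ _ ?_
      have := f.isSobolev.ae_comb g.isSobolev 1 1
      simp only [one_smul] at this
      exact this
    rw [h2]
    simp only [h1]
    rfl
  map_smul' a f := by
    have h1 : ∀ k : Fin ℓ, iteratedDeriv k (a • f).toFun (ω k) =
        a * iteratedDeriv k f.toFun (ω k) := fun k => by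
      have := ((f.isSobolev.deriv_at k).comb a 0 (f.isSobolev.deriv_at k)).2
      simp only [zero_smul, zero_mul, add_zero] at this
      exact this
    have h2 : (a • f).isSobolev.memLp.toLp _ = a • f.isSobolev.memLp.toLp _ := by
      rw [← MemLp.toLp_const_smul]
      refine MemLp.toLp_congr _ _ ?_
      have := f.isSobolev.ae_comb f.isSobolev a 0
      simp only [zero_smul, add_zero] at this
      exact this
    rw [h2]
    simp only [h1]
    rfl

theorem norm_dataMap (f : SobolevFun p α β ω) : ‖dataMap f‖ = ‖f‖ := by
  have hp0 : 0 < p := by linarith [hp.out]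
  have hpr : (ENNReal.ofReal p).toReal = p := ENNReal.toReal_ofReal hp0.le
  have h0 : 0 < (ENNReal.ofReal p).toReal := by rw [hpr]; exact hp0
  rw [norm_def, sobolevNorm, WithLp.prod_norm_eq_add h0, PiLp.norm_eq_sum h0, hpr]
  have h1 : 0 ≤ ∑ k : Fin ℓ, |iteratedDeriv k f.toFun (ω k)| ^ p := by positivity
  congr 2
  · change ((∑ k : Fin ℓ, |iteratedDeriv k f.toFun (ω k)| ^ p) ^ (1 / p)) ^ p = _
    rw [one_div, Real.rpow_inv_rpow h1 hp0.ne']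
  · change ‖f.isSobolev.memLp.toLp _‖ ^ p = _
    rw [Lp.norm_toLp, integral_eq_eLpNorm hp.out f.isSobolev.memLp,
      abs_of_nonneg ENNReal.toReal_nonneg]

theorem isometry_dataMap :
    Isometry (dataMap : SobolevFun p α β ω →ₗ[ℝ] DataSpace p α β ℓ) :=
  AddMonoidHomClass.isometry_of_norm _ norm_dataMap

/-- Only the `L^p` component has to be approximated: an `ℓ`-fold antiderivative of the approximating
polynomial can be given the point values exactly. -/
theorem denseRange_dataMap_polynomial :
    DenseRange fun P : SobolevPoly p α β ω => dataMap (SobolevPoly.toFun P) := by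
  have hp0 : 0 < p := by linarith [hp.out]
  have hpr : (ENNReal.ofReal p).toReal = p := ENNReal.toReal_ofReal hp0.le
  have h0 : 0 < (ENNReal.ofReal p).toReal := by rw [hpr]; exact hp0
  intro y
  refine Metric.mem_closure_range_iff.2 fun ε hε => ?_
  obtain ⟨R, hR⟩ := exists_polynomial_eLpNorm_sub_le hp.out (Lp.memLp y.snd)
    (ε := ENNReal.ofReal (ε / 2)) (by simpa using hε)
  obtain ⟨P, hP, hPv⟩ := exists_polynomial_data ω (fun k => y.fst k) R
  let P' : SobolevPoly p α β ω := P
  refine ⟨P', ?_⟩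
  have hfst : (y - dataMap (SobolevPoly.toFun P')).fst = 0 := by
    ext k
    change y.fst k - iteratedDeriv k (fun x => P.eval x) (ω k) = 0
    rw [hPv, sub_self]
  have hsnd : ‖(y - dataMap (SobolevPoly.toFun P')).snd‖ ≤ ε / 2 := by
    change ‖y.snd - (SobolevPoly.toFun P').isSobolev.memLp.toLp _‖ ≤ _
    rw [Lp.norm_def]
    refine ENNReal.toReal_le_of_le_ofReal (by positivity) (le_trans (le_of_eq ?_) hR)
    refine eLpNorm_congr_ae ?_
    refine (Lp.coeFn_sub _ _).trans ?_
    filter_upwards [MemLp.coeFn_toLp (SobolevPoly.toFun P').isSobolev.memLp] with x hx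
    rw [Pi.sub_apply, Pi.sub_apply, hx]
    exact congrArg _ (congrFun hP x)
  rw [dist_eq_norm, WithLp.prod_norm_eq_add h0, hfst, norm_zero, hpr, Real.zero_rpow hp0.ne',
    zero_add, one_div, Real.rpow_rpow_inv (norm_nonneg _) hp0.ne']
  linarith

theorem denseRange_polynomial :
    DenseRange (SobolevPoly.toFun : SobolevPoly p α β ω →ₗ[ℝ] SobolevFun p α β ω) := by
  intro f
  refine Metric.mem_closure_range_iff.2 fun ε hε => ?_
  obtain ⟨P, hP⟩ := Metric.denseRange_iff.1 denseRange_dataMap_polynomial (dataMap f) ε hε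
  exact ⟨P, by rwa [isometry_dataMap.dist_eq] at hP⟩

/-! ### Completeness as solvability of `f^(ℓ) = g` -/

variable (p α β ω) in
/-- Every element of `L^p(μ)` is the derivative of order `ℓ` of a function in the Sobolev space. -/
def IsSolvable : Prop :=
  ∀ g : ℝ → ℝ, MemLp g (ENNReal.ofReal p) (jacobiMeasure α β) →
    ∃ f, IsSobolev p α β ω f ∧ iteratedDeriv ℓ f =ᵐ[jacobiMeasure α β] g

/-- The point values are no constraint: a polynomial with vanishing derivative of order `ℓ` corrects
them. -/
theorem surjective_dataMap_iff :
    Function.Surjective (dataMap : SobolevFun p α β ω →ₗ[ℝ] DataSpace p α β ℓ) ↔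
      IsSolvable p α β ω := by
  constructor
  · intro h g hg
    obtain ⟨f, hf⟩ := h (WithLp.toLp _ (0, hg.toLp g))
    refine ⟨f.toFun, f.isSobolev, ?_⟩
    have h1 : f.isSobolev.memLp.toLp _ = hg.toLp g := congrArg (fun y => y.snd) hf
    exact (MemLp.toLp_eq_toLp_iff _ _).1 h1
  · intro h y
    obtain ⟨f, hf, hfg⟩ := h _ (Lp.memLp y.snd)
    obtain ⟨P, hP, hPv⟩ := exists_polynomial_data ω
      (fun k => y.fst k - iteratedDeriv k f (ω k)) 0
    have hPs := isSobolev_polynomial (p := p) (α := α) (β := β) (ω := ω) P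
    have hs := hf.comb hPs 1 1
    refine ⟨(⟨_, hs⟩ : preU p α β ω), ?_⟩
    have h1 : ∀ k : Fin ℓ,
        iteratedDeriv k ((1 : ℝ) • f + (1 : ℝ) • fun x => P.eval x) (ω k) = y.fst k := fun k => by
      rw [((hf.deriv_at k).comb 1 1 (hPs.deriv_at k)).2, hPv]
      ring
    have h2 : hs.memLp.toLp _ = y.snd := by
      rw [← Lp.toLp_coeFn y.snd (Lp.memLp y.snd)]
      refine MemLp.toLp_congr _ _ ((hf.ae_comb hPs 1 1).trans ?_)
      filter_upwards [hfg] with x hx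
      rw [Pi.add_apply, Pi.smul_apply, Pi.smul_apply, hx, hP]
      simp
    change WithLp.toLp _ (WithLp.toLp _ _, hs.memLp.toLp _) = y
    rw [h2]
    have h3 : (WithLp.toLp (ENNReal.ofReal p) fun k : Fin ℓ =>
        iteratedDeriv k ((1 : ℝ) • f + (1 : ℝ) • fun x => P.eval x) (ω k)) = y.fst := by
      ext k; exact h1 k
    exact congrArg (fun v => WithLp.toLp (ENNReal.ofReal p) (v, y.snd)) h3

/-- The separation quotient does not affect completeness. An isometric image in a complete space is
complete iff it is closed, and this image is dense, so closed means everything. -/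
theorem completeSpace_U_iff : CompleteSpace (U p α β ω) ↔ IsSolvable p α β ω := by
  rw [← surjective_dataMap_iff,
    ← SeparationQuotient.isUniformInducing_mk.completeSpace_congr SeparationQuotient.surjective_mk,
    completeSpace_iff_isComplete_range isometry_dataMap.isUniformInducing]
  constructor
  · intro h
    have hd : Dense (range (dataMap : SobolevFun p α β ω →ₗ[ℝ] DataSpace p α β ℓ)) :=
      denseRange_dataMap_polynomial.mono (range_comp_subset_range _ _)
    rw [← range_eq_univ, ← h.isClosed.closure_eq, hd.closure_eq]
  · intro h
    rw [h.range_eq]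
    exact completeSpace_iff_isComplete_univ.1 inferInstance

/-- The polynomials map to dense subspaces of two complete spaces with equal norms, so their
identity map extends. -/
theorem exists_linearIsometryEquiv_of_completeSpace (h : CompleteSpace (U p α β ω)) :
    ∃ e : U p α β ω ≃ₗᵢ[ℝ] W p α β ω, ∀ P : SobolevPoly p α β ω, e (polyU P) = polyW P := by
  let i₁ : SobolevPoly p α β ω →ₗ[ℝ] U p α β ω :=
    (SeparationQuotient.mkCLM ℝ (SobolevFun p α β ω)).toLinearMap ∘ₗ SobolevPoly.toFun
  let i₂ : SobolevPoly p α β ω →ₗ[ℝ] W p α β ω :=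
    (UniformSpace.Completion.toComplL (𝕜 := ℝ) (E := SobolevPoly p α β ω)).toLinearMap
  have hd₁ : DenseRange i₁ := SeparationQuotient.surjective_mk.denseRange.comp
    denseRange_polynomial SeparationQuotient.continuous_mk
  have hd₂ : DenseRange i₂ := UniformSpace.Completion.denseRange_coe
  have hn : ∀ P, ‖i₂ (LinearEquiv.refl ℝ _ P)‖ = ‖i₁ P‖ := fun P =>
    (UniformSpace.Completion.norm_coe P).trans
      (SeparationQuotient.norm_mk (SobolevPoly.toFun P)).symm
  exact ⟨(LinearEquiv.refl ℝ _).extendOfIsometry i₁ i₂ hd₁ hd₂ hn,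
    fun P => LinearEquiv.extendOfIsometry_eq (LinearEquiv.refl ℝ _) i₁ i₂ hd₁ hd₂ hn P⟩

end

/-! ### Derivatives of a given order at a point -/

theorem HasDerivOfOrder.mono {f : ℝ → ℝ} {j k : ℕ} {x : ℝ} (h : HasDerivOfOrder f k x)
    (hjk : j ≤ k) : HasDerivOfOrder f j x := by
  induction hjk with
  | refl => exact h
  | step _ ih => exact ih h.1.self_of_nhds

/-- A function that is the first one of a chain of successive derivatives on an open set. -/
theorem hasDerivOfOrder_of_chain {u : ℕ → ℝ → ℝ} {O : Set ℝ} (hO : IsOpen O) {n : ℕ}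
    (hu : ∀ j < n, ∀ y ∈ O, HasDerivAt (u j) (u (j + 1) y) y) {f : ℝ → ℝ} (hf : EqOn f (u 0) O) :
    ∀ k ≤ n, ∀ y ∈ O, HasDerivOfOrder f k y ∧ iteratedDeriv k f y = u k y := by
  intro k
  induction k with
  | zero => exact fun _ y hy => ⟨trivial, by rw [iteratedDeriv_zero, hf hy]⟩
  | succ k ih =>
    intro hk y hy
    have hd : HasDerivAt (iteratedDeriv k f) (u (k + 1) y) y := by
      refine (hu k hk y hy).congr_of_eventuallyEq ?_
      filter_upwards [hO.mem_nhds hy] with z hz using (ih (by omega) z hz).2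
    refine ⟨⟨?_, hd.differentiableAt⟩, by rw [iteratedDeriv_succ, hd.deriv]⟩
    filter_upwards [hO.mem_nhds hy] with z hz using (ih (by omega) z hz).1

theorem HasDerivOfOrder.hasDerivAt {f : ℝ → ℝ} {j k : ℕ} {x : ℝ} (h : HasDerivOfOrder f k x)
    (hjk : j < k) : HasDerivAt (iteratedDeriv j f) (iteratedDeriv (j + 1) f x) x := by
  rw [iteratedDeriv_succ]
  exact (h.mono (Nat.succ_le_of_lt hjk)).2.hasDerivAt

/-! ### Reflection -/

theorem iteratedDeriv_reflect (k : ℕ) (f : ℝ → ℝ) :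
    iteratedDeriv k (fun x => f (-x)) = fun x => (-1 : ℝ) ^ k * iteratedDeriv k f (-x) :=
  funext fun x => by simpa using iteratedDeriv_comp_neg k f x

theorem HasDerivOfOrder.reflect {f : ℝ → ℝ} {k : ℕ} : ∀ {x : ℝ},
    HasDerivOfOrder f k (-x) → HasDerivOfOrder (fun x => f (-x)) k x := by
  induction k with
  | zero => exact fun _ => trivial
  | succ k ih =>
    refine fun {x} h => ⟨?_, ?_⟩
    · filter_upwards [(continuous_neg.tendsto x).eventually h.1] with y hy using ih hy
    · rw [iteratedDeriv_reflect]
      exact (h.2.comp x differentiableAt_id.neg).const_mul _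

theorem _root_.AbsolutelyContinuousOnInterval.congr {f g : ℝ → ℝ} {a b : ℝ}
    (hf : AbsolutelyContinuousOnInterval f a b) (h : EqOn g f (uIcc a b)) :
    AbsolutelyContinuousOnInterval g a b := by
  rw [absolutelyContinuousOnInterval_iff] at hf ⊢
  intro ε hε
  obtain ⟨δ, hδ, hf⟩ := hf ε hε
  refine ⟨δ, hδ, fun E hE hl => lt_of_le_of_lt (le_of_eq ?_) (hf E hE hl)⟩
  exact Finset.sum_congr rfl fun i hi => by rw [h (hE.1 i hi).1, h (hE.1 i hi).2]

/-- An absolutely continuous function is the integral of its derivative, and the substitution `t ↦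
-t` is available for integrals. -/
theorem _root_.AbsolutelyContinuousOnInterval.reflect {f : ℝ → ℝ} {a b : ℝ}
    (hf : AbsolutelyContinuousOnInterval f (-a) (-b)) :
    AbsolutelyContinuousOnInterval (fun x => f (-x)) a b := by
  have hint : IntervalIntegrable (fun x => deriv f (-x)) volume a b := by
    have := hf.intervalIntegrable_deriv.comp_mul_left (c := -1)
    simpa using this
  have h1 := (hint.const_mul (-1)).absolutelyContinuousOnInterval_intervalIntegral
    (c := a) left_mem_uIcc
  have h2 : AbsolutelyContinuousOnInterval (fun _ => f (-a)) a b :=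
    contDiff_const.contDiffOn.absolutelyContinuousOnInterval
  refine (h1.add h2).congr fun x hx => ?_
  have h3 : AbsolutelyContinuousOnInterval f (-a) (-x) :=
    hf.mono (by
      rw [← image_neg_uIcc, ← image_neg_uIcc]
      exact image_mono (uIcc_subset_uIcc_left hx))
  have h4 := h3.integral_deriv_eq_sub
  simp only [Pi.add_apply, intervalIntegral.integral_const_mul,
    intervalIntegral.integral_comp_neg]
  rw [intervalIntegral.integral_symm, h4]
  ring

theorem measurePreserving_neg_jacobi (α β : ℝ) :
    MeasurePreserving Neg.neg (jacobiMeasure α β) (jacobiMeasure β α) := by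
  refine ⟨measurable_neg, Measure.ext fun s hs => ?_⟩
  rw [Measure.map_apply measurable_neg hs, jacobiMeasure, jacobiMeasure,
    withDensity_apply _ (measurable_neg hs), withDensity_apply _ hs,
    Measure.restrict_restrict (measurable_neg hs), Measure.restrict_restrict hs]
  have h := (Measure.measurePreserving_neg (volume : Measure ℝ)).setLIntegral_comp_preimage_emb
    (MeasurableEquiv.neg ℝ).measurableEmbedding
    (fun x => ENNReal.ofReal ((1 - x) ^ β * (1 + x) ^ α)) (s ∩ Icc (-1) 1)
  have h2 : Neg.neg ⁻¹' (s ∩ Icc (-1 : ℝ) 1) = Neg.neg ⁻¹' s ∩ Icc (-1 : ℝ) 1 := by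
    ext x
    simp only [mem_preimage, mem_inter_iff, mem_Icc]
    constructor <;> rintro ⟨h1, h2, h3⟩ <;> exact ⟨h1, by linarith, by linarith⟩
  rw [h2] at h
  rw [← h]
  refine lintegral_congr fun x => ?_
  rw [sub_neg_eq_add, ← sub_eq_add_neg, mul_comm]

theorem MemLp.reflect {α β p : ℝ} {g : ℝ → ℝ}
    (hg : MemLp g (ENNReal.ofReal p) (jacobiMeasure α β)) :
    MemLp (fun x => g (-x)) (ENNReal.ofReal p) (jacobiMeasure β α) :=
  hg.comp_measurePreserving (measurePreserving_neg_jacobi β α)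

variable {p α β : ℝ} {ℓ : ℕ} {ω : Fin ℓ → ℝ}

theorem IsSobolev.reflect {f : ℝ → ℝ} (hf : IsSobolev p α β ω f) :
    IsSobolev p β α (-ω) (fun x => f (-x)) where
  deriv_at k := HasDerivOfOrder.reflect (by simpa using hf.deriv_at k)
  deriv_on x hx := HasDerivOfOrder.reflect (hf.deriv_on _ ⟨by linarith [hx.2], by linarith [hx.1]⟩)
  absCont a b ha hab hb := by
    rw [iteratedDeriv_reflect]
    exact (hf.absCont (-b) (-a) (by linarith) (by linarith) (by linarith)).symm.reflect.const_mul _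
  memLp := by
    rw [iteratedDeriv_reflect]
    exact (MemLp.reflect hf.memLp).const_mul _

theorem IsSolvable.reflect (h : IsSolvable p α β ω) : IsSolvable p β α (-ω) := by
  intro g hg
  obtain ⟨f, hf, hfg⟩ := h _ ((MemLp.reflect hg).const_mul ((-1) ^ ℓ))
  refine ⟨_, hf.reflect, ?_⟩
  rw [iteratedDeriv_reflect]
  filter_upwards [(measurePreserving_neg_jacobi β α).quasiMeasurePreserving.ae hfg] with x hx
  rw [hx, neg_neg, ← mul_assoc, ← mul_pow]
  simp

/-! ### Iterated primitives -/

/-- The primitive of `g` that vanishes at `0`. -/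
def primitive (g : ℝ → ℝ) (x : ℝ) : ℝ := ∫ t in (0 : ℝ)..x, g t

theorem continuousOn_primitive {g : ℝ → ℝ} (hg : ∀ b < 1, IntervalIntegrable g volume 0 b) :
    ContinuousOn (primitive g) (Iio 1) := by
  intro x hx
  obtain ⟨b, hxb, hb⟩ := exists_between (max_lt hx (zero_lt_one (α := ℝ)))
  have h0b : 0 < b := (le_max_right _ _).trans_lt hxb
  obtain ⟨a, ha⟩ := exists_lt (min x 0)
  have ha0 : a < 0 := ha.trans_le (min_le_right _ _)
  -- The hypothesis includes negative bounds, hence integrability on both sides of `0`.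
  have hab : IntervalIntegrable g volume a b := (hg a (by linarith)).symm.trans (hg b hb)
  have hab' : IntegrableOn g (uIcc a b) := by
    rw [uIcc_of_le (by linarith)]
    exact (intervalIntegrable_iff_integrableOn_Icc_of_le (by linarith)).1 hab
  have h := intervalIntegral.continuousOn_primitive_interval' hab
    (show (0 : ℝ) ∈ uIcc a b by rw [uIcc_of_le (by linarith)]; exact ⟨ha0.le, h0b.le⟩)
  refine (h.continuousAt ?_).continuousWithinAt
  rw [uIcc_of_le (by linarith)]
  exact Icc_mem_nhds (ha.trans_le (min_le_left _ _)) ((le_max_left _ _).trans_lt hxb)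

theorem uIcc_zero_subset_Iio {x : ℝ} (hx : x < 1) : uIcc 0 x ⊆ Iio 1 := fun _ hy =>
  hy.2.trans_lt (max_lt one_pos hx)

theorem hasDerivAt_primitive {g : ℝ → ℝ} {O : Set ℝ} (hO : IsOpen O)
    (h0 : ∀ x ∈ O, uIcc 0 x ⊆ O) (hg : ContinuousOn g O) {x : ℝ} (hx : x ∈ O) :
    HasDerivAt (primitive g) (g x) x :=
  intervalIntegral.integral_hasDerivAt_right (hg.mono (h0 x hx)).intervalIntegrable
    (hg.stronglyMeasurableAtFilter hO x hx) (hg.continuousAt (hO.mem_nhds hx))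

theorem continuousOn_iterate_primitive {g : ℝ → ℝ}
    (hg : ∀ b < 1, IntervalIntegrable g volume 0 b) (m : ℕ) :
    ContinuousOn (primitive^[m + 1] g) (Iio 1) := by
  induction m with
  | zero => exact continuousOn_primitive hg
  | succ m ih =>
    rw [Function.iterate_succ_apply']
    exact continuousOn_primitive fun b hb =>
      (ih.mono (uIcc_zero_subset_Iio hb)).intervalIntegrable

theorem continuous_iterate_primitive {g : ℝ → ℝ} (hg : Continuous g) (m : ℕ) :
    Continuous (primitive^[m] g) := by
  induction m with
  | zero => exact hg
  | succ m ih =>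
    rw [Function.iterate_succ_apply']
    exact intervalIntegral.continuous_primitive (fun a b => ih.intervalIntegrable a b) 0

theorem iterate_primitive_congr {g h : ℝ → ℝ} (hgh : EqOn g h (Iio 1)) (m : ℕ) :
    EqOn (primitive^[m] g) (primitive^[m] h) (Iio 1) := by
  induction m with
  | zero => exact hgh
  | succ m ih =>
    intro x hx
    rw [Function.iterate_succ_apply', Function.iterate_succ_apply']
    exact intervalIntegral.integral_congr fun t ht => ih (uIcc_zero_subset_Iio hx ht)

/-- Taking a primitive costs one power of `1 - t`. By Tonelli on the triangle `s < t`, the integral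
of `(1 - t)^m ∫_0^t |g|` is that of `|g s| ∫_s^1 (1 - t)^m dt`, and the inner integral is at most
`(1 - s)^m (1 - s)`. -/
theorem integrableOn_pow_mul_primitive {g : ℝ → ℝ} {m : ℕ}
    (hg : ∀ b < 1, IntervalIntegrable g volume 0 b)
    (hgm : AEStronglyMeasurable g (volume.restrict (Ioo 0 1)))
    (hint : IntegrableOn (fun t => (1 - t) ^ (m + 1) * g t) (Ioo 0 1)) :
    IntegrableOn (fun t => (1 - t) ^ m * primitive g t) (Ioo 0 1) := by
  refine ⟨?_, ?_⟩
  · refine ContinuousOn.aestronglyMeasurable ?_ measurableSet_Ioo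
    exact (by fun_prop : Continuous fun t : ℝ => (1 - t) ^ m).continuousOn.mul
      ((continuousOn_primitive hg).mono fun x hx => hx.2)
  set ν := (volume : Measure ℝ).restrict (Ioo 0 1)
  let F : ℝ → ℝ → ENNReal := fun t s =>
    (Iio t).indicator (fun s => ENNReal.ofReal ((1 - t) ^ m) * ‖g s‖ₑ) s
  have hF : AEMeasurable (Function.uncurry F) (ν.prod ν) := by
    have h1 : AEMeasurable
        (fun q : ℝ × ℝ => ENNReal.ofReal ((1 - q.1) ^ m) * ‖g q.2‖ₑ) (ν.prod ν) :=
      AEMeasurable.mul (by fun_prop) hgm.enorm.comp_snd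
    have h2 : Function.uncurry F = {q : ℝ × ℝ | q.2 < q.1}.indicator
        (fun q : ℝ × ℝ => ENNReal.ofReal ((1 - q.1) ^ m) * ‖g q.2‖ₑ) := by
      ext ⟨t, s⟩; rfl
    rw [h2]
    exact h1.indicator (measurableSet_lt measurable_snd measurable_fst)
  have h1 : ∫⁻ t, ‖(1 - t) ^ m * primitive g t‖ₑ ∂ν ≤ ∫⁻ t, ∫⁻ s, F t s ∂ν ∂ν := by
    refine setLIntegral_mono_ae' measurableSet_Ioo (Eventually.of_forall fun t ht => ?_)
    have h3 : ∫⁻ s, F t s ∂ν = ENNReal.ofReal ((1 - t) ^ m) * ∫⁻ s in Ioo 0 t, ‖g s‖ₑ := by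
      simp only [F]
      rw [lintegral_indicator measurableSet_Iio, Measure.restrict_restrict measurableSet_Iio,
        lintegral_const_mul' _ _ ENNReal.ofReal_ne_top]
      congr 3
      ext x
      simp only [mem_inter_iff, mem_Iio, mem_Ioo]
      exact ⟨fun h => ⟨h.2.1, h.1⟩, fun h => ⟨h.2, h.1, h.2.trans ht.2⟩⟩
    rw [h3, enorm_mul, Real.enorm_of_nonneg (pow_nonneg (by linarith [ht.2]) m)]
    gcongr
    rw [primitive, intervalIntegral.integral_of_le ht.1.le, integral_Ioc_eq_integral_Ioo]
    exact enorm_integral_le_lintegral_enorm _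
  have h2 : ∫⁻ s, ∫⁻ t, F t s ∂ν ∂ν ≤ ∫⁻ s, ‖(1 - s) ^ (m + 1) * g s‖ₑ ∂ν := by
    refine setLIntegral_mono_ae' measurableSet_Ioo (Eventually.of_forall fun s hs => ?_)
    have h3 : ∀ t ∈ Ioo (0 : ℝ) 1, F t s ≤
        (Ioi s).indicator (fun _ => ENNReal.ofReal ((1 - s) ^ m) * ‖g s‖ₑ) t := by
      intro t ht
      by_cases hst : s < t
      · simp only [F]
        rw [indicator_of_mem (mem_Iio.2 hst), indicator_of_mem (mem_Ioi.2 hst)]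
        gcongr
        linarith [ht.2]
      · simp only [F]
        rw [indicator_of_notMem (by simpa using hst)]
        exact zero_le
    refine (setLIntegral_mono_ae' measurableSet_Ioo (Eventually.of_forall h3)).trans ?_
    rw [lintegral_indicator measurableSet_Ioi, Measure.restrict_restrict measurableSet_Ioi,
      setLIntegral_const]
    have h4 : Ioi s ∩ Ioo 0 1 = Ioo s 1 := by
      ext x
      simp only [mem_inter_iff, mem_Ioi, mem_Ioo]
      exact ⟨fun h => ⟨h.1, h.2.2⟩, fun h => ⟨h.1, hs.1.trans h.1, h.2⟩⟩
    rw [h4, Real.volume_Ioo, enorm_mul,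
      Real.enorm_of_nonneg (pow_nonneg (by linarith [hs.2]) (m + 1)), pow_succ,
      ENNReal.ofReal_mul (pow_nonneg (by linarith [hs.2]) m)]
    exact le_of_eq (by ring)
  rw [HasFiniteIntegral]
  rw [lintegral_lintegral_swap hF] at h1
  exact (h1.trans h2).trans_lt hint.2

/-- If `(1 - t)^m g` is integrable at `1`, then the primitive of `g` of order `m + 1` has a limit
there. -/
theorem exists_tendsto_iterate_primitive (m : ℕ) : ∀ {g : ℝ → ℝ},
    (∀ b < 1, IntervalIntegrable g volume 0 b) →
    AEStronglyMeasurable g (volume.restrict (Ioo 0 1)) →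
    IntegrableOn (fun t => (1 - t) ^ m * g t) (Ioo 0 1) →
    ∃ L, Tendsto (primitive^[m + 1] g) (𝓝[<] 1) (𝓝 L) := by
  induction m with
  | zero =>
    intro g _ _ h
    simp only [pow_zero, one_mul] at h
    have h1 : IntegrableOn g (uIcc 0 1) := by
      rw [uIcc_of_le zero_le_one]
      exact (integrableOn_Icc_iff_integrableOn_Ioo).2 h
    have h2 := intervalIntegral.continuousOn_primitive_interval h1
    rw [uIcc_of_le zero_le_one] at h2
    refine ⟨_, (h2 1 ⟨zero_le_one, le_rfl⟩).mono_left ?_⟩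
    rw [nhdsWithin_Icc_eq_nhdsLE zero_lt_one]
    exact nhdsWithin_mono _ Iio_subset_Iic_self
  | succ m ih =>
    intro g hg hgm h
    have hc := continuousOn_primitive hg
    -- The induction hypothesis is applied to `primitive g`, for which one power of `1 - t` less is
    -- needed.
    exact ih (fun b hb => (hc.mono (uIcc_zero_subset_Iio hb)).intervalIntegrable)
      ((hc.mono fun x hx => hx.2).aestronglyMeasurable measurableSet_Ioo)
      (integrableOn_pow_mul_primitive hg hgm h)

/-- A function whose derivative of order `n + m` on `(-∞, 1)` is the primitive of `g`, and that has
a derivative of order `n` at `1` and all derivatives on `(1, ∞)`. -/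
theorem exists_iterated_primitive {n m : ℕ} {g : ℝ → ℝ}
    (hg : ∀ b < 1, IntervalIntegrable g volume 0 b)
    (hgm : AEStronglyMeasurable g (volume.restrict (Ioo 0 1)))
    (hint : n = 0 ∨ IntegrableOn (fun t => (1 - t) ^ m * g t) (Ioo 0 1)) :
    ∃ f : ℝ → ℝ, (∀ x < 1, HasDerivOfOrder f (n + m) x ∧
        iteratedDeriv (n + m) f x = primitive g x) ∧
      (∀ j, ∀ x > 1, HasDerivOfOrder f j x) ∧ HasDerivOfOrder f n 1 := by
  obtain ⟨L, hL⟩ : ∃ L, n = 0 ∨ Tendsto (primitive^[m + 1] g) (𝓝[<] 1) (𝓝 L) := by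
    rcases hint with h | h
    · exact ⟨0, Or.inl h⟩
    · obtain ⟨L, hL⟩ := exists_tendsto_iterate_primitive m hg hgm h
      exact ⟨L, Or.inr hL⟩
  -- `H` is the prospective derivative of order `n`, frozen at its limit from `1` on. The limit
  -- makes it continuous at `1`, which is needed only if `n > 0`; for `n = 0` it may jump, with the
  -- default `L = 0`.
  let H : ℝ → ℝ := fun x => if x < 1 then primitive^[m + 1] g x else L
  have hHlt : EqOn H (primitive^[m + 1] g) (Iio 1) := fun x hx => if_pos hx
  have hHge : EqOn H (fun _ => L) (Ici 1) := fun x hx => if_neg (not_lt.2 hx)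
  have hHc : n = 0 ∨ Continuous H := by
    rcases hL with h | hL
    · exact Or.inl h
    refine Or.inr (continuous_iff_continuousAt.2 fun x => ?_)
    rcases lt_trichotomy x 1 with hx | rfl | hx
    · exact ((continuousOn_iterate_primitive hg m).continuousAt (Iio_mem_nhds hx)).congr
        (eventually_of_mem (Iio_mem_nhds hx) fun y hy => (hHlt hy).symm)
    · rw [continuousAt_iff_continuous_left'_right']
      have h1 : H 1 = L := hHge self_mem_Ici
      constructor
      · rw [ContinuousWithinAt, h1]
        exact hL.congr' (eventually_of_mem self_mem_nhdsWithin fun y hy => (hHlt hy).symm)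
      · rw [ContinuousWithinAt, h1]
        exact tendsto_const_nhds.congr'
          (eventually_of_mem self_mem_nhdsWithin fun y hy => (hHge (mem_Ioi.1 hy).le).symm)
    · exact continuousAt_const.congr
        (eventually_of_mem (Ioi_mem_nhds hx) fun y hy => (hHge (mem_Ioi.1 hy).le).symm)
  have hstep : ∀ j < n, ∀ x, HasDerivAt (primitive^[n - j] H) (primitive^[n - (j + 1)] H x) x := by
    intro j hj x
    have hc : Continuous H := hHc.resolve_left (by omega)
    rw [show n - j = (n - (j + 1)) + 1 by omega, Function.iterate_succ_apply']
    exact hasDerivAt_primitive isOpen_univ (fun _ _ => subset_univ _)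
      (continuous_iterate_primitive hc _).continuousOn (mem_univ x)
  refine ⟨primitive^[n] H, fun x hx => ?_, fun j x hx => ?_, ?_⟩
  -- On `(-∞, 1)` the function is the primitive of `g` of order `n + m + 1`, and each derivative
  -- removes one integration.
  · have key := hasDerivOfOrder_of_chain (u := fun j => primitive^[n + m + 1 - j] g) isOpen_Iio
      (n := n + m) (f := primitive^[n] H) ?_ ?_ (n + m) le_rfl x hx
    · rwa [show n + m + 1 - (n + m) = 1 by omega, Function.iterate_one] at key
    · intro j hj y hy
      rw [show n + m + 1 - j = (n + m - 1 - j + 1) + 1 by omega,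
        show n + m + 1 - (j + 1) = n + m - 1 - j + 1 by omega, Function.iterate_succ_apply' _ (_ + 1)]
      exact hasDerivAt_primitive isOpen_Iio (fun _ => uIcc_zero_subset_Iio)
        (continuousOn_iterate_primitive hg _) hy
    · refine (iterate_primitive_congr hHlt n).trans fun y _ => ?_
      rw [← Function.iterate_add_apply]
      rfl
  -- To the right of `1` the derivative of order `n` is constant, so the chain continues with zeros.
  · refine (hasDerivOfOrder_of_chain
      (u := fun j => if j ≤ n then primitive^[n - j] H else 0) isOpen_Ioi (n := j)
      (f := primitive^[n] H) ?_ ?_ j le_rfl x hx).1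
    · intro i _ y hy
      rcases lt_trichotomy i n with hi | rfl | hi
      · rw [if_pos hi.le, if_pos (by omega : i + 1 ≤ n)]
        exact hstep i hi y
      · rw [if_pos le_rfl, if_neg (by omega), Nat.sub_self]
        exact (hasDerivAt_const y L).congr_of_eventuallyEq
          (eventually_of_mem (Ioi_mem_nhds hy) fun z hz => hHge (mem_Ioi.1 hz).le)
      · rw [if_neg (by omega), if_neg (by omega)]
        exact hasDerivAt_const y 0
    · intro y _
      simp
  · exact (hasDerivOfOrder_of_chain (u := fun j => primitive^[n - j] H) isOpen_univ
      (fun j hj y _ => hstep j hj y) (fun y _ => rfl) n le_rfl 1 (mem_univ _)).1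

/-! ### Weighted integrability near an end point -/

theorem memLp_jacobi_iff (hp : 1 ≤ p) {g : ℝ → ℝ} (hg : Measurable g) :
    MemLp g (ENNReal.ofReal p) (jacobiMeasure α β) ↔
      IntegrableOn (fun t => (1 - t) ^ α * (1 + t) ^ β * |g t| ^ p) (Ioo (-1) 1) := by
  have hp0 : 0 < p := by linarith
  rw [← integrable_norm_rpow_iff hg.aestronglyMeasurable (by simpa using hp0)
    ENNReal.ofReal_ne_top, ENNReal.toReal_ofReal hp0.le, jacobiMeasure,
    integrable_withDensity_iff_integrable_smul' (by fun_prop)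
      (Eventually.of_forall fun _ => ENNReal.ofReal_lt_top),
    Measure.restrict_congr_set (Ioo_ae_eq_Icc (μ := volume) (a := (-1 : ℝ)) (b := 1)).symm]
  refine integrableOn_congr_fun (fun t ht => ?_) measurableSet_Ioo
  have h1 : 0 < 1 - t := by linarith [ht.2]
  have h2 : 0 < 1 + t := by linarith [ht.1]
  simp only [smul_eq_mul, Real.norm_eq_abs]
  rw [ENNReal.toReal_ofReal (by positivity)]

/-- On `[0, 1]` both `(1 + t)^β` and its inverse are continuous, so this factor of the weight is
irrelevant. -/
theorem memLp_jacobi_iff_of_support (hp : 1 ≤ p) {g : ℝ → ℝ} (hg : Measurable g)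
    (h0 : ∀ t ∉ Ioo (0 : ℝ) 1, g t = 0) :
    MemLp g (ENNReal.ofReal p) (jacobiMeasure α β) ↔
      IntegrableOn (fun t => (1 - t) ^ α * |g t| ^ p) (Ioo 0 1) := by
  have hp0 : 0 < p := by linarith
  have hcont : ∀ γ : ℝ, ContinuousOn (fun t : ℝ => (1 + t) ^ γ) (Icc 0 1) := fun γ t ht =>
    (ContinuousAt.rpow_const (by fun_prop) (Or.inl (by linarith [ht.1]))).continuousWithinAt
  rw [memLp_jacobi_iff hp hg]
  constructor
  · intro h
    have h1 := (integrableOn_Icc_iff_integrableOn_Ioo enorm_ne_top enorm_ne_top).2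
      (h.mono_set (Ioo_subset_Ioo_left (by norm_num : (-1 : ℝ) ≤ 0)))
    refine ((h1.mul_continuousOn (hcont (-β)) isCompact_Icc).mono_set
      Ioo_subset_Icc_self).congr_fun (fun t ht => ?_) measurableSet_Ioo
    have h2 : 0 < 1 + t := by linarith [ht.1]
    have h3 : (1 + t) ^ β * (1 + t) ^ (-β) = 1 := by
      rw [← Real.rpow_add h2, add_neg_cancel, Real.rpow_zero]
    calc (1 - t) ^ α * (1 + t) ^ β * |g t| ^ p * (1 + t) ^ (-β)
        = (1 - t) ^ α * |g t| ^ p * ((1 + t) ^ β * (1 + t) ^ (-β)) := by ring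
      _ = _ := by rw [h3, mul_one]
  · intro h
    have h1 := ((integrableOn_Icc_iff_integrableOn_Ioo enorm_ne_top enorm_ne_top).2
      h).mul_continuousOn (hcont β) isCompact_Icc
    refine ((h1.mono_set Ioo_subset_Icc_self).congr_fun (fun t ht => ?_)
      measurableSet_Ioo).of_forall_sdiff_eq_zero measurableSet_Ioo fun t ht => ?_
    · ring
    · rw [h0 t ht.2, abs_zero, Real.zero_rpow hp0.ne', mul_zero]

theorem integrableOn_one_sub_rpow {r : ℝ} (hr : -1 < r) :
    IntegrableOn (fun t : ℝ => (1 - t) ^ r) (Ioo 0 1) := by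
  have h := ((intervalIntegral.intervalIntegrable_rpow' (a := 0) (b := 1) hr).comp_sub_left 1).symm
  simp only [sub_zero, sub_self] at h
  exact (intervalIntegrable_iff_integrableOn_Ioo_of_le zero_le_one).1 h

/-- On `[0, b]` the function `(1 - t)^(-α)` is continuous, which removes the weight; then `|g| ≤ 1 +
|g|^p`. For negative `b` the function vanishes on the interval. -/
theorem intervalIntegrable_of_weighted (hp : 1 ≤ p) {g : ℝ → ℝ} (hg : Measurable g)
    (h0 : ∀ t ∉ Ioo (0 : ℝ) 1, g t = 0)
    (hint : IntegrableOn (fun t => (1 - t) ^ α * |g t| ^ p) (Ioo 0 1)) :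
    ∀ b < 1, IntervalIntegrable g volume 0 b := by
  intro b hb
  have h1 : IntegrableOn (fun t => (1 - t) ^ α * |g t| ^ p) (Icc 0 b) :=
    ((integrableOn_Ico_iff_integrableOn_Ioo enorm_ne_top).2 hint).mono_set (Icc_subset_Ico_right hb)
  have hc : ContinuousOn (fun t : ℝ => (1 - t) ^ (-α)) (Icc 0 b) := fun t ht =>
    (ContinuousAt.rpow_const (by fun_prop) (Or.inl (by linarith [ht.2]))).continuousWithinAt
  have h2 : IntegrableOn (fun t => |g t| ^ p) (Icc 0 b) := by
    refine (h1.mul_continuousOn hc isCompact_Icc).congr_fun (fun t ht => ?_) measurableSet_Icc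
    have h2 : 0 < 1 - t := by linarith [ht.2]
    have h3 : (1 - t) ^ α * (1 - t) ^ (-α) = 1 := by
      rw [← Real.rpow_add h2, add_neg_cancel, Real.rpow_zero]
    calc (1 - t) ^ α * |g t| ^ p * (1 - t) ^ (-α)
        = |g t| ^ p * ((1 - t) ^ α * (1 - t) ^ (-α)) := by ring
      _ = _ := by rw [h3, mul_one]
  have h3 : IntegrableOn g (Ioc 0 b) := by
    have h4 : IntegrableOn (fun t => 1 + |g t| ^ p) (Ioc 0 b) :=
      (integrableOn_const (by simp)).add (h2.mono_set Ioc_subset_Icc_self)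
    refine Integrable.mono' h4 hg.aestronglyMeasurable (Eventually.of_forall fun t => ?_)
    rw [Real.norm_eq_abs]
    rcases le_total |g t| 1 with h | h
    · have : 0 ≤ |g t| ^ p := by positivity
      linarith
    · have := Real.rpow_le_rpow_of_exponent_le h hp
      rw [Real.rpow_one] at this
      linarith
  rw [intervalIntegrable_iff]
  refine h3.of_forall_sdiff_eq_zero measurableSet_uIoc fun t ht => h0 t fun h => ht.2 ⟨h.1, ?_⟩
  rcases mem_uIoc.1 ht.1 with h' | h'
  · exact h'.2
  · linarith [h.1, h'.2]

/-- The inequality under which `(1 - t)^m g` is integrable at `1` for all `g` in the weighted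
`L^p`. -/
def EndpointInequality (p α : ℝ) (m : ℕ) : Prop :=
  (1 < p ∧ α < m * p - 1) ∨ (p = 1 ∧ α ≤ m - 1)

/-- For `p > 1`, Young's inequality is applied to `(1 - t)^(α/p) |g|` and `(1 - t)^(m - α/p)`. The
conjugate power of the latter is integrable because `(m - α/p) q > -1` amounts to `α < (m + 1) p -
1`. For `p = 1`, `α ≤ m` gives `(1 - t)^m ≤ (1 - t)^α`. -/
theorem integrableOn_pow_mul_of_weighted {m : ℕ} {g : ℝ → ℝ} (hg : Measurable g)
    (hint : IntegrableOn (fun t => (1 - t) ^ α * |g t| ^ p) (Ioo 0 1))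
    (h : EndpointInequality p α (m + 1)) :
    IntegrableOn (fun t => (1 - t) ^ m * g t) (Ioo 0 1) := by
  have hm : AEStronglyMeasurable (fun t => (1 - t) ^ m * g t) (volume.restrict (Ioo 0 1)) :=
    Measurable.aestronglyMeasurable (by fun_prop)
  rcases h with ⟨hp, h⟩ | ⟨rfl, h⟩
  · have hpq := Real.HolderConjugate.conjExponent hp
    set q := p.conjExponent with hq
    have hp1 : 0 < p - 1 := by linarith
    have hr : -1 < (m - α / p) * q := by
      have : ((m : ℝ) - α / p) * q = (m * p - α) / (p - 1) := by
        rw [hq, Real.conjExponent]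
        field_simp
      rw [this, lt_div_iff₀ hp1]
      push_cast at h
      linarith
    refine Integrable.mono' ((hint.div_const p).add ((integrableOn_one_sub_rpow hr).div_const q)) hm
      ((ae_restrict_iff' measurableSet_Ioo).2 (Eventually.of_forall fun t ht => ?_))
    have h1 : 0 < 1 - t := by linarith [ht.2]
    have hy := Real.young_inequality_of_nonneg (a := (1 - t) ^ (α / p) * |g t|)
      (b := (1 - t) ^ (m - α / p)) (by positivity) (by positivity) hpq
    have h2 : (1 - t) ^ (α / p) * (1 - t) ^ ((m : ℝ) - α / p) = (1 - t) ^ m := by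
      rw [← Real.rpow_add h1, add_sub_cancel, Real.rpow_natCast]
    rw [Real.mul_rpow (by positivity) (abs_nonneg _), ← Real.rpow_mul h1.le,
      div_mul_cancel₀ _ (by linarith : p ≠ 0), ← Real.rpow_mul h1.le] at hy
    rw [Real.norm_eq_abs, abs_mul, abs_of_pos (pow_pos h1 m), ← h2]
    refine le_trans (le_of_eq ?_) hy
    ring
  · refine Integrable.mono' hint hm
      ((ae_restrict_iff' measurableSet_Ioo).2 (Eventually.of_forall fun t ht => ?_))
    have h1 : 0 < 1 - t := by linarith [ht.2]
    rw [Real.norm_eq_abs, abs_mul, abs_of_pos (pow_pos h1 m), Real.rpow_one, ← Real.rpow_natCast]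
    push_cast at h
    exact mul_le_mul_of_nonneg_right
      (Real.rpow_le_rpow_of_exponent_ge h1 (by linarith [ht.1]) (by linarith)) (abs_nonneg _)

/-! ### The conditions at the end points are sufficient -/

/-- Here `n` bounds the orders prescribed at `1`. As `g` vanishes left of `0`, its primitives exist
on all of `(-∞, 1)` and the point `-1` causes no trouble. -/
theorem exists_isSobolev_of_support (hp : 1 ≤ p) {n m : ℕ} (hℓ : ℓ = n + m + 1)
    (hω : ∀ k, ω k = 1 → (k : ℕ) ≤ n) (hn : n = 0 ∨ EndpointInequality p α (m + 1))
    {g : ℝ → ℝ} (hgm : Measurable g) (h0 : ∀ t ∉ Ioo (0 : ℝ) 1, g t = 0)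
    (hg : MemLp g (ENNReal.ofReal p) (jacobiMeasure α β)) :
    ∃ f, IsSobolev p α β ω f ∧ iteratedDeriv ℓ f =ᵐ[jacobiMeasure α β] g := by
  have hw := (memLp_jacobi_iff_of_support hp hgm h0).1 hg
  have hi := intervalIntegrable_of_weighted hp hgm h0 hw
  obtain ⟨f, hf1, hf2, hf3⟩ := exists_iterated_primitive (n := n) (m := m) hi
    hgm.aestronglyMeasurable (hn.imp_right fun h => integrableOn_pow_mul_of_weighted hgm hw h)
  have hae : iteratedDeriv ℓ f =ᵐ[jacobiMeasure α β] g := by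
    apply ae_jacobi_of_ae
    -- `g` need not be integrable up to `1`, so Lebesgue differentiation is used on countably many
    -- intervals ending before `1`.
    obtain ⟨u, _, hu1, hu⟩ := exists_seq_strictMono_tendsto' (show (-1 : ℝ) < 1 by norm_num)
    have hii : ∀ i, IntervalIntegrable g volume (min 0 (-1)) (max 0 (u i)) := fun i =>
      (hi _ (by norm_num)).symm.trans (hi _ (max_lt one_pos (hu1 i).2))
    filter_upwards [ae_all_iff.2 fun i => (hii i).ae_hasDerivAt_integral] with x hx hx1
    obtain ⟨i, hxi⟩ := (hu.eventually (lt_mem_nhds hx1.2)).exists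
    have hle : min (0 : ℝ) (-1) ≤ max 0 (u i) := (min_le_left _ _).trans (le_max_left _ _)
    have h1 := hx i
      (by
        rw [uIcc_of_le hle]
        exact ⟨(min_le_right _ _).trans hx1.1.le, hxi.le.trans (le_max_right _ _)⟩) 0
      (by rw [uIcc_of_le hle]; exact ⟨min_le_left _ _, le_max_left _ _⟩)
    rw [hℓ, iteratedDeriv_succ]
    refine HasDerivAt.deriv (h1.congr_of_eventuallyEq ?_)
    exact eventually_of_mem (Iio_mem_nhds hx1.2) fun y hy => (hf1 y hy).2
  refine ⟨f, ⟨fun k => ?_, fun x hx => ?_, fun a b ha hab hb => ?_, ?_⟩, hae⟩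
  · rcases lt_trichotomy (ω k) 1 with h | h | h
    · exact (hf1 _ h).1.mono (by omega)
    · rw [h]
      exact hf3.mono (hω k h)
    · exact hf2 _ _ h
  · exact (hf1 x hx.2).1.mono (by omega)
  · have h1 : IntervalIntegrable g volume (min a 0) (max b 0) :=
      (hi _ (min_lt_of_right_lt one_pos)).symm.trans (hi _ (max_lt hb one_pos))
    have hle : min a 0 ≤ max b 0 := (min_le_right _ _).trans (le_max_right _ _)
    refine ((h1.absolutelyContinuousOnInterval_intervalIntegral (c := 0) ?_).mono ?_).congr ?_
    · rw [uIcc_of_le hle]; exact ⟨min_le_right _ _, le_max_right _ _⟩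
    · rw [uIcc_of_le hle, uIcc_of_le hab]
      exact Icc_subset_Icc (min_le_left _ _) (le_max_left _ _)
    · intro x hx
      rw [uIcc_of_le hab] at hx
      rw [show ℓ - 1 = n + m by omega]
      exact (hf1 x (hx.2.trans_lt hb)).2
  · exact (memLp_congr_ae hae).2 hg

/-- The condition at the end point `1` for the completeness of `U`. -/
def EndpointCondition (p α : ℝ) {ℓ : ℕ} (ω : Fin ℓ → ℝ) : Prop :=
  ∀ k : Fin ℓ, (k : ℕ) ≠ 0 → ω k = 1 → EndpointInequality p α (ℓ - k)

/-- Only the largest `k` with `ω k = 1` matters, since a derivative of order `k` at `1` includes all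
lower ones. If no node is `1`, the choice `n = 0` requires no inequality. -/
theorem EndpointCondition.exists_isSobolev (hℓ : 1 ≤ ℓ) (hp : 1 ≤ p) (h : EndpointCondition p α ω)
    {g : ℝ → ℝ} (hgm : Measurable g) (h0 : ∀ t ∉ Ioo (0 : ℝ) 1, g t = 0)
    (hg : MemLp g (ENNReal.ofReal p) (jacobiMeasure α β)) :
    ∃ f, IsSobolev p α β ω f ∧ iteratedDeriv ℓ f =ᵐ[jacobiMeasure α β] g := by
  by_cases hne : ∃ k, ω k = 1
  · obtain ⟨k, hk, hmax⟩ := (Finset.univ.filter fun k => ω k = 1).exists_max_image (fun k => k)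
      (by obtain ⟨k, hk⟩ := hne; exact ⟨k, by simpa using hk⟩)
    have hk1 : ω k = 1 := by simpa using hk
    refine exists_isSobolev_of_support hp (n := k) (m := ℓ - k - 1) (by omega)
      (fun j hj => hmax j (by simpa using hj)) ?_ hgm h0 hg
    rcases Nat.eq_zero_or_pos (k : ℕ) with h1 | h1
    · exact Or.inl h1
    · have := h k h1.ne' hk1
      rw [show ℓ - (k : ℕ) = ℓ - k - 1 + 1 by omega] at this
      exact Or.inr this
  · exact exists_isSobolev_of_support hp (n := 0) (m := ℓ - 1) (by omega)
      (fun k hk => (hne ⟨k, hk⟩).elim) (Or.inl rfl) hgm h0 hg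

/-- `g` is split at `0`. The left half is reflected, solved on the right and reflected back; the
factor `(-1)^ℓ` compensates the chain rule. -/
theorem isSolvable_of_endpointCondition (hℓ : 1 ≤ ℓ) (hp : 1 ≤ p) (h1 : EndpointCondition p α ω)
    (h2 : EndpointCondition p β (-ω)) : IsSolvable p α β ω := by
  intro g₀ hg₀
  obtain ⟨g, hgm, hg⟩ := hg₀.1
  have hgL := (memLp_congr_ae hg).1 hg₀
  obtain ⟨f₁, hf₁, hfg₁⟩ := h1.exists_isSobolev (β := β) hℓ hp
    (hgm.measurable.indicator measurableSet_Ioo) (fun t ht => indicator_of_notMem ht g)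
    (hgL.indicator measurableSet_Ioo)
  obtain ⟨f₂, hf₂, hfg₂⟩ := h2.exists_isSobolev (β := α) hℓ hp
    (g := (Ioo 0 1).indicator fun x => (-1) ^ ℓ * g (-x))
    (Measurable.indicator (by have := hgm.measurable; fun_prop) measurableSet_Ioo)
    (fun t ht => indicator_of_notMem ht _)
    (((MemLp.reflect hgL).const_mul _).indicator measurableSet_Ioo)
  have hf₃ := hf₂.reflect
  rw [neg_neg] at hf₃
  refine ⟨_, hf₁.comb hf₃ 1 1, (hf₁.ae_comb hf₃ 1 1).trans ?_⟩
  have hne : ∀ᵐ x ∂jacobiMeasure α β, x ≠ 0 ∧ x ∈ Ioo (-1 : ℝ) 1 := by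
    apply ae_jacobi_of_ae
    filter_upwards [Measure.ae_ne volume (0 : ℝ)] with x hx hx1 using ⟨hx, hx1⟩
  filter_upwards [hne, hg, hfg₁,
    (measurePreserving_neg_jacobi α β).quasiMeasurePreserving.ae hfg₂] with x hx hx0 hx1 hx2
  rw [Pi.add_apply, Pi.smul_apply, Pi.smul_apply, hx1, iteratedDeriv_reflect]
  simp only
  rw [hx2, one_smul, one_smul, hx0]
  rcases lt_or_gt_of_ne hx.1 with h | h
  · rw [indicator_of_notMem (fun h' => by linarith [h'.1]),
      indicator_of_mem (show -x ∈ Ioo (0 : ℝ) 1 from ⟨by linarith, by linarith [hx.2.1]⟩), neg_neg, zero_add, ← mul_assoc,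
      ← mul_pow]
    simp
  · rw [indicator_of_mem (show x ∈ Ioo (0 : ℝ) 1 from ⟨h, hx.2.2⟩), indicator_of_notMem (fun h' => by linarith [h'.1]), mul_zero,
      add_zero]

/-! ### The conditions at the end points are necessary -/

theorem ae_of_ae_jacobi {q : ℝ → Prop} (h : ∀ᵐ x ∂(jacobiMeasure α β), q x) :
    ∀ᵐ x ∂volume, x ∈ Ioo (-1 : ℝ) 1 → q x := by
  rw [jacobiMeasure, ae_withDensity_iff (by fun_prop),
    Measure.restrict_congr_set (Ioo_ae_eq_Icc (μ := volume) (a := (-1 : ℝ)) (b := 1)).symm,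
    ae_restrict_iff' measurableSet_Ioo] at h
  filter_upwards [h] with x hx hx1
  refine hx hx1 (ENNReal.ofReal_pos.2 ?_).ne'
  have h1 : 0 < 1 - x := by linarith [hx1.2]
  have h2 : 0 < 1 + x := by linarith [hx1.1]
  positivity

/-- A chain of derivatives whose last member is bounded consists of bounded functions. -/
theorem exists_bound_of_chain {a : ℕ → ℝ → ℝ} {m : ℕ}
    (ha : ∀ j < m, ∀ x ∈ Ioo (0 : ℝ) 1, HasDerivAt (a j) (a (j + 1) x) x)
    (hm : ∃ C, ∀ x ∈ Ioo (0 : ℝ) 1, |a m x| ≤ C) :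
    ∀ j ≤ m, ∃ C, ∀ x ∈ Ioo (0 : ℝ) 1, |a j x| ≤ C := by
  intro j hj
  induction hj using Nat.decreasingInduction with
  | self => exact hm
  | of_succ j hj ih =>
    obtain ⟨C, hC⟩ := ih
    have h2 : (1 / 2 : ℝ) ∈ Ioo (0 : ℝ) 1 := by norm_num
    have hC0 : 0 ≤ C := (abs_nonneg _).trans (hC _ h2)
    refine ⟨|a j (1 / 2)| + C, fun x hx => ?_⟩
    have h1 := (convex_Ioo (0 : ℝ) 1).norm_image_sub_le_of_norm_hasDerivWithin_le
      (fun y hy => (ha j hj y hy).hasDerivWithinAt) hC h2 hx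
    rw [Real.norm_eq_abs, Real.norm_eq_abs] at h1
    have h3 : |x - 1 / 2| ≤ 1 := abs_le.2 ⟨by linarith [hx.1], by linarith [hx.2]⟩
    have h4 : C * |x - 1 / 2| ≤ C := mul_le_of_le_one_right hC0 h3
    have h5 := abs_sub_abs_le_abs_sub (a j x) (a j (1 / 2))
    linarith

/-- A solution for `φ (m + 1)` on `(0, 1)` would satisfy `f^(k) = φ 0` up to a bounded function. If
`φ 0` tended to infinity, so would the derivative of `f^(k-1)`, against its differentiability at
`1`. -/
theorem IsSolvable.not_tendsto_atTop (hp : 1 ≤ p) (h : IsSolvable p α β ω) {k : Fin ℓ}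
    (hk : (k : ℕ) ≠ 0) (hω : ω k = 1) {m : ℕ} (hm : ℓ = k + m + 1) {φ : ℕ → ℝ → ℝ}
    (hφ : ∀ j ≤ m, ∀ x ∈ Ioo (0 : ℝ) 1, HasDerivAt (φ j) (φ (j + 1) x) x)
    (hφm : Measurable (φ (m + 1))) (hφc : ContinuousOn (φ (m + 1)) (Ioo 0 1))
    (hint : IntegrableOn (fun t => (1 - t) ^ α * |φ (m + 1) t| ^ p) (Ioo 0 1)) :
    ¬ Tendsto (φ 0) (𝓝[<] 1) atTop := by
  intro htop
  set g := (Ioo (0 : ℝ) 1).indicator (φ (m + 1)) with hg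
  have hgL : MemLp g (ENNReal.ofReal p) (jacobiMeasure α β) := by
    refine (memLp_jacobi_iff_of_support hp (hφm.indicator measurableSet_Ioo)
      fun t ht => indicator_of_notMem ht _).2 (hint.congr_fun (fun t ht => ?_) measurableSet_Ioo)
    rw [indicator_of_mem ht]
  obtain ⟨f, hf, hfg⟩ := h g hgL
  have hsub : Ioo (0 : ℝ) 1 ⊆ Ioo (-1) 1 := Ioo_subset_Ioo_left (by norm_num)
  have hhalf : (1 / 2 : ℝ) ∈ Ioo (0 : ℝ) 1 := by norm_num
  let a : ℕ → ℝ → ℝ := fun j x => iteratedDeriv (k + j) f x - φ j x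
  have ha : ∀ j < m, ∀ x ∈ Ioo (0 : ℝ) 1, HasDerivAt (a j) (a (j + 1) x) x := fun j hj x hx =>
    ((hf.deriv_on x (hsub hx)).hasDerivAt (j := k + j) (by omega)).sub (hφ j hj.le x hx)
  -- Equality of the last derivatives holds only almost everywhere; absolute continuity of `f^(ℓ-1)`
  -- makes the difference of the primitives constant.
  have hconst : ∀ x ∈ Ioo (0 : ℝ) 1, a m x = a m (1 / 2) := by
    intro x hx
    have huIcc : uIcc (1 / 2) x ⊆ Ioo (0 : ℝ) 1 := (convex_Ioo 0 1).ordConnected.uIcc_subset hhalf hx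
    have h1 : ∫ t in (1 / 2 : ℝ)..x, deriv (iteratedDeriv (k + m) f) t =
        iteratedDeriv (k + m) f x - iteratedDeriv (k + m) f (1 / 2) := by
      have hac := hf.absCont (min (1 / 2) x) (max (1 / 2) x)
        ((by norm_num : (-1 : ℝ) < 0).trans (lt_min hhalf.1 hx.1)) min_le_max
        (max_lt hhalf.2 hx.2)
      rw [show ℓ - 1 = k + m by omega] at hac
      refine (hac.mono ?_).integral_deriv_eq_sub
      rw [uIcc_of_le min_le_max]
      rfl
    have h2 : ∫ t in (1 / 2 : ℝ)..x, φ (m + 1) t = φ m x - φ m (1 / 2) :=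
      intervalIntegral.integral_eq_sub_of_hasDerivAt (fun t ht => hφ m le_rfl t (huIcc ht))
        (hφc.mono huIcc).intervalIntegrable
    have h3 : ∫ t in (1 / 2 : ℝ)..x, deriv (iteratedDeriv (k + m) f) t =
        ∫ t in (1 / 2 : ℝ)..x, φ (m + 1) t := by
      refine intervalIntegral.integral_congr_ae ?_
      filter_upwards [ae_of_ae_jacobi hfg] with t ht ht1
      have ht2 := huIcc (uIoc_subset_uIcc ht1)
      rw [← iteratedDeriv_succ, ← hm, ht (hsub ht2), hg, indicator_of_mem ht2]
    simp only [a]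
    linarith
  obtain ⟨C, hC⟩ := exists_bound_of_chain ha ⟨_, fun x hx => (congrArg abs (hconst x hx)).le⟩ 0
    (Nat.zero_le m)
  have hIoo : ∀ᶠ x in 𝓝[<] (1 : ℝ), x ∈ Ioo (0 : ℝ) 1 := Ioo_mem_nhdsLT zero_lt_one
  have htop' : Tendsto (iteratedDeriv k f) (𝓝[<] 1) atTop := by
    refine tendsto_atTop_mono' _ ?_ (tendsto_atTop_add_const_right _ (-C) htop)
    filter_upwards [hIoo] with x hx
    have := (abs_le.1 (hC x hx)).1
    simp only [a, add_zero] at this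
    linarith
  obtain ⟨j, hj⟩ := Nat.exists_eq_succ_of_ne_zero hk
  have hd := hf.deriv_at k
  rw [hj, hω] at hd
  rw [hj, Nat.succ_eq_add_one, iteratedDeriv_succ] at htop'
  exact not_differentiableWithinAt_of_deriv_tendsto_atTop_Iio _ htop'
    hd.2.differentiableWithinAt

/-! ### Logarithmic counterexamples at the end point -/

/-- The polynomials in the derivatives of functions of `1 - log (1 - t)`. -/
def logPoly (P : Polynomial ℝ) : ℕ → Polynomial ℝ
  | 0 => P
  | j + 1 => Polynomial.C (j + 1 : ℝ) * logPoly P j -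
      Polynomial.X ^ 2 * Polynomial.derivative (logPoly P j)

/-- The derivatives of a function `φ` with derivative `(1 - t)⁻¹ P((1 - log (1 - t))⁻¹)`. -/
def logChain (φ : ℝ → ℝ) (P : Polynomial ℝ) : ℕ → ℝ → ℝ
  | 0 => φ
  | j + 1 => fun t => ((1 - t) ^ (j + 1))⁻¹ * (logPoly P j).eval (1 - Real.log (1 - t))⁻¹

/-- The summand `1` keeps the inverse of `1 - log (1 - t)` in `(0, 1]`, where polynomials are
bounded. -/
theorem one_le_one_sub_log {t : ℝ} (ht : t ∈ Ioo (0 : ℝ) 1) : 1 ≤ 1 - Real.log (1 - t) := by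
  linarith [Real.log_nonpos (by linarith [ht.2] : 0 ≤ 1 - t) (by linarith [ht.1])]

theorem hasDerivAt_one_sub_log {t : ℝ} (ht : t ∈ Ioo (0 : ℝ) 1) :
    HasDerivAt (fun t => 1 - Real.log (1 - t)) (1 - t)⁻¹ t := by
  have h1 : 1 - t ≠ 0 := by linarith [ht.2]
  have := (((hasDerivAt_id t).const_sub 1).log h1).const_sub 1
  convert! this using 1
  simp only [id]
  field_simp

/-- With `L = 1 - log (1 - t)` one has `(L⁻¹)' = -(1 - t)⁻¹ L⁻²`; the product rule is then the
recursion of `logPoly`. -/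
theorem hasDerivAt_logChain {φ : ℝ → ℝ} {P : Polynomial ℝ}
    (hφ : ∀ t ∈ Ioo (0 : ℝ) 1,
      HasDerivAt φ ((1 - t)⁻¹ * P.eval (1 - Real.log (1 - t))⁻¹) t) (j : ℕ) :
    ∀ t ∈ Ioo (0 : ℝ) 1, HasDerivAt (logChain φ P j) (logChain φ P (j + 1) t) t := by
  intro t ht
  rcases j with _ | j
  · simpa [logChain, logPoly] using hφ t ht
  · have h1 : 1 - t ≠ 0 := by linarith [ht.2]
    have hL : 1 - Real.log (1 - t) ≠ 0 := by linarith [one_le_one_sub_log ht]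
    have h2 : HasDerivAt (fun t : ℝ => ((1 - t) ^ (j + 1))⁻¹)
        ((j + 1) * ((1 - t) ^ (j + 2))⁻¹) t := by
      have := (((hasDerivAt_id t).const_sub 1).pow (j + 1)).inv (pow_ne_zero _ h1)
      convert! this using 1
      rw [Nat.add_sub_cancel]
      simp only [id, Pi.pow_apply]
      push_cast
      field_simp
      ring
    have h3 := (hasDerivAt_one_sub_log ht).inv hL
    have h4 := h2.mul (((logPoly P j).hasDerivAt _).comp t h3)
    convert! h4 using 1
    simp only [logChain, logPoly, Polynomial.eval_sub, Polynomial.eval_mul, Polynomial.eval_C,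
      Polynomial.eval_pow, Polynomial.eval_X, Function.comp_apply, Pi.inv_apply]
    field_simp
    ring

theorem measurable_logChain (φ : ℝ → ℝ) (P : Polynomial ℝ) (j : ℕ) :
    Measurable (logChain φ P (j + 1)) := by
  have h := (logPoly P j).continuous.measurable
  have h1 : Measurable fun t : ℝ => (1 - Real.log (1 - t))⁻¹ := by fun_prop
  exact Measurable.mul (by fun_prop) (h.comp h1)

/-- A factor `(1 - log (1 - t))⁻¹` thus survives in every derivative; its power `p` gives
integrability at the critical exponent. -/
theorem X_dvd_logPoly {P : Polynomial ℝ} (hP : Polynomial.X ∣ P) (j : ℕ) :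
    Polynomial.X ∣ logPoly P j := by
  induction j with
  | zero => exact hP
  | succ j ih => exact dvd_sub (ih.mul_left _) ((dvd_pow_self _ two_ne_zero).mul_right _)

theorem exists_bound_eval (Q : Polynomial ℝ) :
    ∃ C, 0 ≤ C ∧ ∀ t ∈ Ioo (0 : ℝ) 1, |Q.eval (1 - Real.log (1 - t))⁻¹| ≤ C := by
  obtain ⟨C, hC⟩ := (isCompact_Icc (a := (0 : ℝ)) (b := 1)).exists_bound_of_continuousOn
    Q.continuous.continuousOn
  refine ⟨C, (norm_nonneg _).trans (hC 0 (by simp)), fun t ht => hC _ ?_⟩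
  have := one_le_one_sub_log ht
  exact ⟨by positivity, inv_le_one_of_one_le₀ this⟩

theorem tendsto_neg_log_one_sub :
    Tendsto (fun t : ℝ => -Real.log (1 - t)) (𝓝[<] 1) atTop := by
  refine tendsto_neg_atBot_atTop.comp (Real.tendsto_log_nhdsGT_zero.comp ?_)
  refine tendsto_nhdsWithin_iff.2 ⟨?_, eventually_of_mem self_mem_nhdsWithin fun t ht =>
    mem_Ioi.2 (sub_pos.2 ht)⟩
  have : Tendsto (fun t : ℝ => 1 - t) (𝓝 1) (𝓝 (1 - 1)) :=
    tendsto_const_nhds.sub tendsto_id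
  rw [sub_self] at this
  exact this.mono_left nhdsWithin_le_nhds

/-- The integrand is nonnegative with antiderivative `(1 - log (1 - t))^(1 - p) / (1 - p)`, which
tends to `0` at `1` because `p > 1` and so extends continuously to `[0, 1]`. -/
theorem integrableOn_inv_mul_log_rpow (hp : 1 < p) :
    IntegrableOn (fun t : ℝ => (1 - t)⁻¹ * ((1 - Real.log (1 - t))⁻¹) ^ p) (Ioo 0 1) := by
  let ψ : ℝ → ℝ := fun t => if t < 1 then (1 - Real.log (1 - t)) ^ (1 - p) / (1 - p) else 0
  have hψ : EqOn ψ (fun t => (1 - Real.log (1 - t)) ^ (1 - p) / (1 - p)) (Iio 1) :=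
    fun t ht => if_pos ht
  have hcont : ContinuousOn ψ (Icc 0 1) := by
    intro t ht
    rcases ht.2.lt_or_eq with h | rfl
    · refine ContinuousAt.continuousWithinAt ?_
      refine ContinuousAt.congr ?_ (eventually_of_mem (Iio_mem_nhds h) fun y hy => (hψ hy).symm)
      have h1 : 1 - t ≠ 0 := by linarith
      have h2 : 1 ≤ 1 - Real.log (1 - t) := by
        linarith [Real.log_nonpos (by linarith : 0 ≤ 1 - t) (by linarith [ht.1])]
      refine ContinuousAt.div_const (ContinuousAt.rpow_const ?_ (Or.inl (by linarith))) _
      exact continuousAt_const.sub (ContinuousAt.log (by fun_prop) h1)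
    · have h1 : ψ 1 = 0 := if_neg (lt_irrefl _)
      have h2 : Tendsto ψ (𝓝[<] 1) (𝓝 (ψ 1)) := by
        rw [h1]
        have h3 := ((tendsto_rpow_neg_atTop (y := p - 1) (by linarith)).comp
          (tendsto_atTop_add_const_left _ 1 tendsto_neg_log_one_sub)).div_const (1 - p)
        rw [zero_div] at h3
        refine h3.congr' (eventually_of_mem self_mem_nhdsWithin fun t ht => ?_)
        rw [hψ ht]
        simp only [Function.comp_apply, neg_sub, sub_eq_add_neg 1 (Real.log _)]
      have h4 : ContinuousWithinAt ψ (Iio 1) 1 := h2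
      exact ((continuousWithinAt_Iio_iff_Iic).1 h4).mono Icc_subset_Iic_self
  have hder : ∀ t ∈ Ioo (0 : ℝ) 1,
      HasDerivAt ψ ((1 - t)⁻¹ * ((1 - Real.log (1 - t))⁻¹) ^ p) t := by
    intro t ht
    have h1 := one_le_one_sub_log ht
    have h2 := ((hasDerivAt_one_sub_log ht).rpow_const (p := 1 - p)
      (Or.inl (by linarith))).div_const (1 - p)
    refine (h2.congr_of_eventuallyEq
      (eventually_of_mem (Iio_mem_nhds ht.2) fun y hy => hψ hy)).congr_deriv ?_
    have h3 : 1 - p ≠ 0 := by linarith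
    rw [show 1 - p - 1 = -p by ring, Real.rpow_neg (by linarith), Real.inv_rpow (by linarith)]
    field_simp
  refine (intervalIntegral.integrableOn_deriv_of_nonneg hcont hder fun t ht => ?_).mono_set
    Ioo_subset_Ioc_self
  have h1 := one_le_one_sub_log ht
  have h2 : 0 < 1 - t := by linarith [ht.2]
  positivity

theorem IsSolvable.endpointCondition (hp : 1 ≤ p) (h : IsSolvable p α β ω) :
    EndpointCondition p α ω := by
  intro k hk hω
  by_contra hcon
  obtain ⟨m, hm⟩ : ∃ m, ℓ = k + m + 1 := ⟨ℓ - k - 1, by omega⟩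
  have hlk : ℓ - (k : ℕ) = m + 1 := by omega
  rw [hlk] at hcon
  have hderiv0 : ∀ t ∈ Ioo (0 : ℝ) 1, HasDerivAt (fun t => -Real.log (1 - t)) (1 - t)⁻¹ t :=
    fun t ht => by
      have := (hasDerivAt_one_sub_log ht).sub_const 1
      refine this.congr_of_eventuallyEq (Eventually.of_forall fun y => ?_)
      ring
  -- It remains to find a `φ` that blows up at `1` and has an integrable majorant for the weighted
  -- power of its derivative of order `m + 1`.
  have main : ∀ (φ : ℝ → ℝ) (P : Polynomial ℝ),
      (∀ t ∈ Ioo (0 : ℝ) 1, HasDerivAt φ ((1 - t)⁻¹ * P.eval (1 - Real.log (1 - t))⁻¹) t) →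
      Tendsto φ (𝓝[<] 1) atTop →
      (∃ G : ℝ → ℝ, IntegrableOn G (Ioo 0 1) ∧ ∀ t ∈ Ioo (0 : ℝ) 1,
        (1 - t) ^ α * |logChain φ P (m + 1) t| ^ p ≤ G t) → False := by
    rintro φ P hφ htop ⟨G, hG, hle⟩
    have hmeas := measurable_logChain φ P m
    refine h.not_tendsto_atTop hp hk hω hm (φ := logChain φ P)
      (fun j _ => hasDerivAt_logChain hφ j) hmeas
      (fun t ht => (hasDerivAt_logChain hφ (m + 1) t ht).continuousAt.continuousWithinAt) ?_ htop
    refine Integrable.mono' hG (Measurable.aestronglyMeasurable (by fun_prop))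
      ((ae_restrict_iff' measurableSet_Ioo).2 (Eventually.of_forall fun t ht => ?_))
    have h1 : 0 < 1 - t := by linarith [ht.2]
    rw [Real.norm_of_nonneg (by positivity)]
    exact hle t ht
  have hpow : ∀ t ∈ Ioo (0 : ℝ) 1,
      (1 - t) ^ α * (((1 - t) ^ (m + 1))⁻¹) ^ p = (1 - t) ^ (α - (m + 1 : ℕ) * p) := by
    intro t ht
    have h1 : 0 < 1 - t := by linarith [ht.2]
    rw [Real.rpow_sub h1, Real.rpow_mul h1.le, Real.rpow_natCast, Real.inv_rpow (by positivity)]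
    rfl
  rcases hp.lt_or_eq with hp1 | rfl
  · have hα : (m + 1 : ℕ) * p - 1 ≤ α := by
      by_contra h1
      exact hcon (Or.inl ⟨hp1, not_le.1 h1⟩)
    obtain ⟨R, hR⟩ := X_dvd_logPoly (P := Polynomial.X) dvd_rfl m
    obtain ⟨C, hC0, hC⟩ := exists_bound_eval R
    -- At `α = (m + 1) p - 1` a single logarithm would leave `(1 - t)⁻¹`, which is not integrable;
    -- the iterated one gains `(1 - log (1 - t))^(-p)`.
    refine main (fun t => Real.log (1 - Real.log (1 - t))) Polynomial.X (fun t ht => ?_) ?_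
      ⟨_, (integrableOn_inv_mul_log_rpow hp1).const_mul (C ^ p), fun t ht => ?_⟩
    · have h1 := (hasDerivAt_one_sub_log ht).log (by linarith [one_le_one_sub_log ht])
      rwa [Polynomial.eval_X, ← div_eq_mul_inv]
    · refine (Real.tendsto_log_atTop.comp
        (tendsto_atTop_add_const_left _ 1 tendsto_neg_log_one_sub)).congr fun t => ?_
      rw [Function.comp_apply, ← sub_eq_add_neg]
    · have h1 : 0 < 1 - t := by linarith [ht.2]
      have h2 := one_le_one_sub_log ht
      have h3 : (1 - t) ^ (α - (m + 1 : ℕ) * p) ≤ (1 - t)⁻¹ := by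
        rw [← Real.rpow_neg_one]
        exact Real.rpow_le_rpow_of_exponent_ge h1 (by linarith [ht.1]) (by linarith)
      have h4 : |R.eval (1 - Real.log (1 - t))⁻¹| ^ p ≤ C ^ p :=
        Real.rpow_le_rpow (abs_nonneg _) (hC t ht) (by linarith)
      simp only [logChain]
      rw [hR, Polynomial.eval_mul, Polynomial.eval_X, abs_mul, abs_mul,
        abs_of_pos (by positivity : (0 : ℝ) < ((1 - t) ^ (m + 1))⁻¹),
        abs_of_pos (by positivity : 0 < (1 - Real.log (1 - t))⁻¹),
        Real.mul_rpow (by positivity) (by positivity), ← mul_assoc, hpow t ht,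
        Real.mul_rpow (by positivity) (by positivity)]
      calc (1 - t) ^ (α - (m + 1 : ℕ) * p) * ((1 - Real.log (1 - t))⁻¹ ^ p *
            |R.eval (1 - Real.log (1 - t))⁻¹| ^ p)
          ≤ (1 - t)⁻¹ * ((1 - Real.log (1 - t))⁻¹ ^ p * C ^ p) := by gcongr
        _ = _ := by ring
  · have hα : (m : ℝ) < α := by
      by_contra h1
      refine hcon (Or.inr ⟨rfl, ?_⟩)
      push_cast
      linarith
    obtain ⟨C, hC0, hC⟩ := exists_bound_eval (logPoly 1 m)
    -- Here `α > m` is strict, so the exponent `α - (m + 1)` exceeds `-1` and a single logarithm is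
    -- enough.
    refine main (fun t => -Real.log (1 - t)) 1 (fun t ht => ?_) tendsto_neg_log_one_sub
      ⟨_, (integrableOn_one_sub_rpow (r := α - (m + 1 : ℕ) * 1)
        (by push_cast; linarith)).mul_const C, fun t ht => ?_⟩
    · simpa using hderiv0 t ht
    · have h1 : 0 < 1 - t := by linarith [ht.2]
      rw [← hpow t ht]
      simp only [logChain, Real.rpow_one]
      rw [abs_mul, abs_of_pos (by positivity : (0 : ℝ) < ((1 - t) ^ (m + 1))⁻¹), ← mul_assoc]
      have := hC t ht
      gcongr

/-! ### The criterion at both end points -/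

theorem isSolvable_iff (hℓ : 1 ≤ ℓ) (hp : 1 ≤ p) :
    IsSolvable p α β ω ↔ EndpointCondition p α ω ∧ EndpointCondition p β (-ω) :=
  ⟨fun h => ⟨h.endpointCondition hp, h.reflect.endpointCondition hp⟩,
    fun h => isSolvable_of_endpointCondition hℓ hp h.1 h.2⟩

theorem endpointCondition_iff :
    (EndpointCondition p α ω ∧ EndpointCondition p β (-ω)) ↔
      ∀ k : Fin ℓ, (k : ℕ) ≠ 0 → (ω k = 1 → EndpointInequality p α (ℓ - k)) ∧
        (ω k = -1 → EndpointInequality p β (ℓ - k)) := by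
  simp only [EndpointCondition, Pi.neg_apply, neg_eq_iff_eq_neg]
  exact ⟨fun h k hk => ⟨h.1 k hk, h.2 k hk⟩, fun h => ⟨fun k hk => (h k hk).1, fun k hk => (h k hk).2⟩⟩

end JacobiSobolev

end

theorem mainTheorem2 {ℓ : ℕ} (hℓ : 1 ≤ ℓ) (p α β : ℝ)
    [Fact (1 ≤ p)] [Fact (-1 < α)] [Fact (-1 < β)] (ω : Fin ℓ → ℝ) :
    (CompleteSpace (JacobiSobolev.U p α β ω) ↔
      (ℓ = 1 ∨
        (2 ≤ ℓ ∧ 1 < p ∧ ∀ (m : ℕ) (hm1 : 1 ≤ m) (hm2 : m ≤ ℓ - 1),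
          ((m : ℝ) * p - 1 ≤ α → ω ⟨ℓ - m, by omega⟩ ≠ 1) ∧
          ((m : ℝ) * p - 1 ≤ β → ω ⟨ℓ - m, by omega⟩ ≠ -1)) ∨
        (2 ≤ ℓ ∧ p = 1 ∧ ∀ (m : ℕ) (hm1 : 1 ≤ m) (hm2 : m ≤ ℓ - 1),
          ((m : ℝ) - 1 < α → ω ⟨ℓ - m, by omega⟩ ≠ 1) ∧
          ((m : ℝ) - 1 < β → ω ⟨ℓ - m, by omega⟩ ≠ -1)))) ∧
    (CompleteSpace (JacobiSobolev.U p α β ω) →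
      ∃ e : JacobiSobolev.U p α β ω ≃ₗᵢ[ℝ] JacobiSobolev.W p α β ω,
        ∀ P : JacobiSobolev.SobolevPoly p α β ω, e (JacobiSobolev.polyU P) = JacobiSobolev.polyW P) := by
  have hp : 1 ≤ p := Fact.out
  refine ⟨?_, JacobiSobolev.exists_linearIsometryEquiv_of_completeSpace⟩
  rw [JacobiSobolev.completeSpace_U_iff, JacobiSobolev.isSolvable_iff hℓ hp,
    JacobiSobolev.endpointCondition_iff]
  -- The substitution `m = ℓ - k` matches the orders `k ≠ 0` with `1 ≤ m ≤ ℓ - 1`.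
  have hidx : ∀ Q : (m : ℕ) → ℝ → Prop,
      (∀ k : Fin ℓ, (k : ℕ) ≠ 0 → Q (ℓ - k) (ω k)) ↔
        ∀ (m : ℕ) (hm1 : 1 ≤ m) (hm2 : m ≤ ℓ - 1), Q m (ω ⟨ℓ - m, by omega⟩) := by
    refine fun Q => ⟨fun h m hm1 hm2 => ?_, fun h k hk => ?_⟩
    · have := h ⟨ℓ - m, by omega⟩ (by simp only; omega)
      simp only at this
      rwa [show ℓ - (ℓ - m) = m by omega] at this
    · have := h (ℓ - k) (by omega) (by omega)
      have hk2 : (⟨ℓ - (ℓ - k), by omega⟩ : Fin ℓ) = k := Fin.ext (by simp only; omega)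
      rwa [hk2] at this
  rw [hidx fun m y => (y = 1 → JacobiSobolev.EndpointInequality p α m) ∧
    (y = -1 → JacobiSobolev.EndpointInequality p β m)]
  rcases hℓ.eq_or_lt with rfl | hℓ2
  · exact ⟨fun _ => Or.inl rfl, fun _ m hm1 hm2 => by omega⟩
  have hℓ1 : ℓ ≠ 1 := by omega
  have h2 : 2 ≤ ℓ := hℓ2
  rcases hp.eq_or_lt with rfl | hp1
  · simp only [JacobiSobolev.EndpointInequality, lt_irrefl, false_and, true_and, false_or, hℓ1, h2]
    refine forall₃_congr fun m _ _ => and_congr ?_ ?_ <;>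
      exact ⟨fun h h1 h2 => absurd (h h2) (not_le.2 h1), fun h h1 => not_lt.1 fun h2 => h h2 h1⟩
  · simp only [JacobiSobolev.EndpointInequality, hp1, hp1.ne', false_and, true_and, or_false,
      false_or, hℓ1, h2]
    refine forall₃_congr fun m _ _ => and_congr ?_ ?_ <;>
      exact ⟨fun h h1 h2 => absurd (h h2) (not_lt.2 h1), fun h h1 => not_le.1 fun h2 => h h2 h1⟩
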